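/- **Conventions.** For a $C_0$-semigroup $(T(t))_{t\ge 0}$ of bounded operators on a complex Banach space $X$ with generator $A$, let $\varrho(A)$ denote the resolvent set and $R(\lambda,A)=(\lambda-A)^{-1}$. If $1\in\varrho(A)$, the Cayley transform of $A$ is the bounded operator $A_d:=(I+A)(I-A)^{-1}$. For $\beta>0$, $(-A)^{-\beta}$ denotes the fractional power of the sectorial operator $-A$ with $0\in\varrho(A)$, $$(-A)^{-\beta}=\frac{\Gamma(m)}{\Gamma(\beta)\Gamma(m-\beta)}\int_0^\infty t^{m-\beta-1}R(t,A)^m\,dt,\qquad m=\lfloor\beta\rfloor+1 .$$ **Proposition.** Consider the following two cases. 1. $(T(t))_{t\ge0}$ is a uniformly bounded $C_0$-semigroup on a complex Hilbert space $H$ with generator $A$ such that $i\mathbb R\subset\varrho(A)$, and $A$ is normal (that is, $A$ is closed, densely defined and $A^*A=AA^*$). 2. $\Omega$ is a locally compact Hausdorff space, and either (i) $X=L^p(\Omega,\mu)$, where $\mu$ is a $\sigma$-finite regular Borel measure on $\Omega$ and $1\le p<\infty$, and $\phi:\Omega\to\mathbb C$ is measurable with essential range contained in the open left half-plane $\mathbb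 C_-=\{z:\operatorname{Re}z<0\}$; or (ii) $X=C_0(\Omega)$ and $\phi:\Omega\to\mathbb C$ is continuous with $\overline{\phi(\Omega)}\subset\mathbb C_-$. In both sub-cases $A$ is the multiplication operator $Af=\phi f$ with domain $D(A)=\{f\in X:\phi f\in X\}$, and $(T(t))_{t\ge0}$ is the $C_0$-semigroup on $X$ generated by $A$. In each case $[0,\infty)\subset\varrho(A)$ and, for every $\beta>0$, the integral defining $(-A)^{-\beta}$ converges absolutely in operator norm, so that $A_d$ and $(-A)^{-\beta}$ are well-defined bounded operators. Moreover, for every $\alpha>0$, if $$\|T(t)(-A)^{-\alpha}\|=O\!\left(\frac1t\right)\qquad (t\to\infty),$$ then $$\|A_d^{\,n}(-A)^{-\alpha-2}\|=O\!\left(\frac1n\right)\qquad (n\to\infty).$$ -/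

import Mathlib

open MeasureTheory Filter Topology Asymptotics Set
open scoped ENNReal ZeroAtInfty LinearPMap

noncomputable section

/-- `T` (restricted to `[0, ∞)`) is a `C₀`-semigroup of bounded operators on `X`. The values of `T`
at negative times are irrelevant. -/
structure IsC0Semigroup {X : Type*} [NormedAddCommGroup X] [NormedSpace ℂ X]
    (T : ℝ → X →L[ℂ] X) : Prop where
  map_zero : T 0 = 1
  map_add : ∀ s t : ℝ, 0 ≤ s → 0 ≤ t → T (s + t) = T s * T t
  continuous_at_zero : ∀ x : X, Tendsto (fun t : ℝ => T t x) (𝓝[>] 0) (𝓝 x)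

/-- `sup_{t ≥ 0} ‖T(t)‖ < ∞`. -/
def IsUniformlyBounded {X : Type*} [NormedAddCommGroup X] [NormedSpace ℂ X]
    (T : ℝ → X →L[ℂ] X) : Prop :=
  ∃ M : ℝ, ∀ t : ℝ, 0 ≤ t → ‖T t‖ ≤ M

/-- `A` is the (infinitesimal) generator of `T`: `x ∈ D(A)` and `A x = y` if and only if
`(T(t) x - x) / t → y` as `t → 0+`. -/
def IsGenerator {X : Type*} [NormedAddCommGroup X] [NormedSpace ℂ X]
    (T : ℝ → X →L[ℂ] X) (A : X →ₗ.[ℂ] X) : Prop :=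
  ∀ x y : X, (x, y) ∈ A.graph ↔
    Tendsto (fun t : ℝ => (t : ℂ)⁻¹ • (T t x - x)) (𝓝[>] 0) (𝓝 y)

namespace LinearPMap

section Banach

variable {X : Type*} [NormedAddCommGroup X] [NormedSpace ℂ X]

/-- `R` is a bounded two-sided inverse of `z - A : D(A) → X`. -/
def IsResolventAt (A : X →ₗ.[ℂ] X) (z : ℂ) (R : X →L[ℂ] X) : Prop :=
  (∀ x : X, ∃ h : R x ∈ A.domain, z • R x - A ⟨R x, h⟩ = x) ∧
    ∀ y : A.domain, R (z • (y : X) - A y) = y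

/-- The resolvent set of an unbounded operator `A`. -/
def resolventSet (A : X →ₗ.[ℂ] X) : Set ℂ :=
  {z | ∃ R : X →L[ℂ] X, IsResolventAt A z R}

open scoped Classical in
/-- The resolvent operator `R(z, A) = (z - A)⁻¹` for `z` in the resolvent set (and `0` for other
`z`). -/
def resolvent (A : X →ₗ.[ℂ] X) (z : ℂ) : X →L[ℂ] X :=
  if h : z ∈ A.resolventSet then h.choose else 0

theorem resolvent_spec {A : X →ₗ.[ℂ] X} {z : ℂ} (hz : z ∈ A.resolventSet) :
    IsResolventAt A z (A.resolvent z) := by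
  rw [resolvent, dif_pos hz]
  exact hz.choose_spec

theorem IsResolventAt.eq_resolvent {A : X →ₗ.[ℂ] X} {z : ℂ} {R : X →L[ℂ] X}
    (hR : IsResolventAt A z R) : A.resolvent z = R := by
  have hz : z ∈ A.resolventSet := ⟨R, hR⟩
  ext x
  obtain ⟨h, hx⟩ := hR.1 x
  have := (resolvent_spec hz).2 ⟨R x, h⟩
  rwa [hx] at this

theorem resolvent_mem {A : X →ₗ.[ℂ] X} {z : ℂ} (hz : z ∈ A.resolventSet) (x : X) :
    A.resolvent z x ∈ A.domain :=
  ((resolvent_spec hz).1 x).1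

theorem apply_resolvent {A : X →ₗ.[ℂ] X} {z : ℂ} (hz : z ∈ A.resolventSet) (x : X) :
    A ⟨A.resolvent z x, resolvent_mem hz x⟩ = z • A.resolvent z x - x := by
  obtain ⟨_, h⟩ := (resolvent_spec hz).1 x
  rw [eq_sub_iff_add_eq, ← eq_sub_iff_add_eq']
  exact h.symm

open scoped Classical in
/-- The Cayley transform `A_d = (I + A)(I - A)⁻¹`, i.e. `A_d x = R(1, A) x + A R(1, A) x`, for `A`
with `1` in its resolvent set (and `0` for other `A`). -/
def cayley (A : X →ₗ.[ℂ] X) : X →L[ℂ] X :=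
  if h : (1 : ℂ) ∈ A.resolventSet then
    { toFun := fun x => A.resolvent 1 x + A ⟨A.resolvent 1 x, resolvent_mem h x⟩
      map_add' := fun x y => by
        rw [apply_resolvent h, apply_resolvent h, apply_resolvent h]
        simp only [_root_.map_add, one_smul]; abel
      map_smul' := fun c x => by
        rw [apply_resolvent h, apply_resolvent h]
        simp only [_root_.map_smul, one_smul, smul_add, smul_sub, RingHom.id_apply]
      cont := by
        simp only [apply_resolvent h]; fun_prop }
  else 0

theorem cayley_apply {A : X →ₗ.[ℂ] X} (h : (1 : ℂ) ∈ A.resolventSet) (x : X) :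
    A.cayley x = A.resolvent 1 x + A ⟨A.resolvent 1 x, resolvent_mem h x⟩ := by
  rw [cayley, dif_pos h]; rfl

theorem cayley_eq {A : X →ₗ.[ℂ] X} (h : (1 : ℂ) ∈ A.resolventSet) :
    A.cayley = (2 : ℂ) • A.resolvent 1 - 1 := by
  ext x
  simp [cayley_apply h, apply_resolvent h, two_smul, add_sub_assoc]

/-- The integrand `t ^ (m - β - 1) R(t, A) ^ m`, `m = ⌊β⌋ + 1`, of the Balakrishnan-Komatsu
formula for `(-A) ^ (-β)`. Note that `R(t, A) = (t + (-A))⁻¹`. -/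
def negFracPowIntegrand (A : X →ₗ.[ℂ] X) (β : ℝ) (t : ℝ) : X →L[ℂ] X :=
  (t ^ (((⌊β⌋₊ + 1 : ℕ) : ℝ) - β - 1)) • (A.resolvent (t : ℂ)) ^ (⌊β⌋₊ + 1)

/-- The integral that defines `(-A) ^ (-β)` converges absolutely (in operator norm). -/
def NegFracPowExists (A : X →ₗ.[ℂ] X) (β : ℝ) : Prop :=
  (∀ t : ℝ, 0 ≤ t → (t : ℂ) ∈ A.resolventSet) ∧
    IntegrableOn (A.negFracPowIntegrand β) (Ioi 0) volume

/-- The fractional power `(-A) ^ (-β)`, `β > 0`, of the boundedly invertible sectorial operator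
`-A`, by the Balakrishnan-Komatsu formula
`(-A) ^ (-β) = Γ(m) / (Γ(β) Γ(m - β)) ∫₀^∞ t ^ (m - β - 1) (t - A) ^ (-m) dt`
with `m = ⌊β⌋ + 1`, the least integer larger than `β`. -/
def negFracPow (A : X →ₗ.[ℂ] X) (β : ℝ) : X →L[ℂ] X :=
  (Real.Gamma ((⌊β⌋₊ + 1 : ℕ) : ℝ) /
      (Real.Gamma β * Real.Gamma (((⌊β⌋₊ + 1 : ℕ) : ℝ) - β))) •
    ∫ t in Ioi (0 : ℝ), A.negFracPowIntegrand β t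

end Banach

/-- A normal operator on a Hilbert space: densely defined, closed, and `A† A = A A†` (equality
of unbounded operators, including their domains). -/
structure IsNormal {H : Type*} [NormedAddCommGroup H] [InnerProductSpace ℂ H] [CompleteSpace H]
    (A : H →ₗ.[ℂ] H) : Prop where
  dense_domain : Dense (A.domain : Set H)
  isClosed : A.IsClosed
  comm : ∀ x z : H, (∃ y, (x, y) ∈ A.graph ∧ (y, z) ∈ A†.graph) ↔
    ∃ y, (x, y) ∈ A†.graph ∧ (y, z) ∈ A.graph

end LinearPMap

/-- The essential range of `φ` with respect to `μ`. -/
def essentialRange {Ω : Type*} [MeasurableSpace Ω] (μ : Measure Ω) (φ : Ω → ℂ) : Set ℂ :=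
  {z | ∀ ε : ℝ, 0 < ε → μ {s | ‖φ s - z‖ < ε} ≠ 0}

/-- The multiplication operator `f ↦ φ f` on `L^p(Ω, μ)` with its maximal domain
`{f ∈ L^p : φ f ∈ L^p}`. -/
def lpMultiplication {Ω : Type*} [MeasurableSpace Ω] (μ : Measure Ω) (p : ℝ≥0∞) (φ : Ω → ℂ) :
    Lp ℂ p μ →ₗ.[ℂ] Lp ℂ p μ where
  domain :=
    { carrier := {f | MemLp (fun s => φ s * f s) p μ}
      zero_mem' := by
        refine (MemLp.zero (ε := ℂ)).ae_eq ?_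
        filter_upwards [Lp.coeFn_zero ℂ p μ] with s hs
        rw [hs]
        simp
      add_mem' := by
        intro f g hf hg
        refine (MemLp.add hf hg).ae_eq ?_
        filter_upwards [Lp.coeFn_add f g] with s hs
        rw [hs]
        simp only [Pi.add_apply, mul_add]
      smul_mem' := by
        intro c f hf
        refine (MemLp.const_smul hf c).ae_eq ?_
        filter_upwards [Lp.coeFn_smul c f] with s hs
        simp only [hs, Pi.smul_apply, smul_eq_mul]
        ring }
  toFun :=
    { toFun := fun f => MemLp.toLp (fun s => φ s * (f : Lp ℂ p μ) s) f.2
      map_add' := by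
        intro f g
        rw [← MemLp.toLp_add]
        refine MemLp.toLp_congr _ _ ?_
        filter_upwards [Lp.coeFn_add (f : Lp ℂ p μ) g] with s hs
        rw [Submodule.coe_add, hs]
        simp only [Pi.add_apply, mul_add]
      map_smul' := by
        intro c f
        rw [RingHom.id_apply, ← MemLp.toLp_const_smul]
        refine MemLp.toLp_congr _ _ ?_
        filter_upwards [Lp.coeFn_smul c (f : Lp ℂ p μ)] with s hs
        simp only [Submodule.coe_smul, hs, Pi.smul_apply, smul_eq_mul]
        ring }

/-- The multiplication operator `f ↦ φ f` on `C₀(Ω)` with its maximal domain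
`{f ∈ C₀(Ω) : φ f ∈ C₀(Ω)}`. -/
def c0Multiplication {Ω : Type*} [TopologicalSpace Ω] (φ : Ω → ℂ) :
    C₀(Ω, ℂ) →ₗ.[ℂ] C₀(Ω, ℂ) where
  domain :=
    { carrier := {f | ∃ g : C₀(Ω, ℂ), ∀ s, g s = φ s * f s}
      zero_mem' := ⟨0, by simp⟩
      add_mem' := by
        rintro f f' ⟨g, hg⟩ ⟨g', hg'⟩
        exact ⟨g + g', fun s => by simp [hg, hg', mul_add]⟩
      smul_mem' := by
        rintro c f ⟨g, hg⟩
        refine ⟨c • g, fun s => ?_⟩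
        simp only [ZeroAtInftyContinuousMap.smul_apply, hg, smul_eq_mul]
        ring }
  toFun :=
    { toFun := fun f => f.2.choose
      map_add' := by
        intro f f'
        ext s
        rw [(f + f').2.choose_spec, ZeroAtInftyContinuousMap.add_apply, f.2.choose_spec,
          f'.2.choose_spec]
        simp [mul_add]
      map_smul' := by
        intro c f
        ext s
        rw [(c • f).2.choose_spec, RingHom.id_apply, ZeroAtInftyContinuousMap.smul_apply,
          f.2.choose_spec]
        simp only [Submodule.coe_smul, ZeroAtInftyContinuousMap.smul_apply, smul_eq_mul]
        ring }

theorem c0Multiplication_apply {Ω : Type*} [TopologicalSpace Ω] (φ : Ω → ℂ)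
    (f : (c0Multiplication φ).domain) (s : Ω) :
    c0Multiplication φ f s = φ s * (f : C₀(Ω, ℂ)) s :=
  f.2.choose_spec s

end

/-!
The transfer of the decay rate rests on one scalar fact. If `(-A)⁻¹` is multiplication by `z`, where
`z = 0` or `Re z > 0`, then `A`, `T(t)`, `(-A) ^ (-α)` and the Cayley transform are multiplication
by `-1 / z`, `e ^ (-t / z)`, `z ^ α` and `(z - 1) / (z + 1)`. The decay
`|e ^ (-t / z)| |z| ^ α ≤ c / t`, tested at `t = 1 / Re (1 / z) = |z| ^ 2 / Re z`, says that
`|z| ^ (α + 2) ≤ C Re z` (`IsInverseCalculus.exists_rpow_le_mul_re`). As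
`|(z - 1) / (z + 1)| ^ 2 = 1 - 4 Re z / |z + 1| ^ 2`, the quantity
`n |(z - 1) / (z + 1)| ^ n Re z` is bounded for bounded `z`
(`nat_mul_norm_cayley_pow_mul_re_le`), which is the claimed rate
(`IsInverseCalculus.isBigO_cayley_pow`).

Normal operators and multiplication operators are treated together: `IsInverseCalculus` asks for a
contractive injective algebra homomorphism `Φ` from `C(K)`, with `K` compact, into the bounded
operators that takes the coordinate function to `(-A)⁻¹`. For such a `Φ`,

* the resolvents `R(t, A)`, `t ≥ 0`, are the images of `z / (1 + t z)`; the Balakrishnan–Komatsu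
  integral converges absolutely in `C(K)`, and its value `z ^ α` follows from Euler's integral for
  the Gamma function and Fubini's theorem (`integral_rpow_mul_inv_add_pow`);
* upper bounds for operators are upper bounds for their symbols, as `Φ` is contractive;
* lower bounds for `T(t) Φ(q)` come from approximate eigenvectors, which exist at every point of `K`
  as `Φ` is injective (`exists_approx_eigenvector`); approximate eigenvectors of the generator are
  approximate eigenvectors of `T(t)` (`IsC0Semigroup.exists_norm_sub_exp_smul_le`), so the
  operators `T(t)` need not be expressed in the calculus
  (`IsInverseCalculus.norm_exp_mul_norm_le`).

For a normal `A`, the operator `(-A)⁻¹` is a bounded normal operator and `Φ` is its continuous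
functional calculus; the lower bound, applied to `q = 1`, also shows that uniform boundedness of the
semigroup confines the spectrum to the closed half-plane, and `iℝ ⊆ ϱ(A)` excludes the boundary. For
multiplication operators `Φ` is composition with `-1 / φ`, and `K` is the essential range, or the
closure of the range, of `-1 / φ`.
-/

/-! ### The scalar Balakrishnan–Komatsu formula -/

theorem integrableOn_rpow_mul_exp_neg_mul {a r : ℝ} (ha : 0 < a) (hr : 0 < r) :
    IntegrableOn (fun t : ℝ => t ^ (a - 1) * Real.exp (-(r * t))) (Ioi 0) := by
  have := integrableOn_rpow_mul_exp_neg_mul_rpow (s := a - 1) (by linarith) one_pos hr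
  simpa [neg_mul] using this

theorem norm_rpow_mul_cexp {t : ℝ} (ht : 0 < t) (b : ℝ) (w : ℂ) :
    ‖((t ^ b : ℝ) : ℂ) * Complex.exp (-(w * t))‖ = t ^ b * Real.exp (-(w.re * t)) := by
  rw [norm_mul, Complex.norm_exp, Complex.norm_real, Real.norm_of_nonneg (by positivity)]
  simp

theorem integrableOn_rpow_mul_cexp_neg_mul {a : ℝ} (ha : 0 < a) {w : ℂ} (hw : 0 < w.re) :
    IntegrableOn (fun t : ℝ => ((t ^ (a - 1) : ℝ) : ℂ) * Complex.exp (-(w * t))) (Ioi 0) := by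
  refine (integrableOn_rpow_mul_exp_neg_mul ha hw).mono'
    (Measurable.aestronglyMeasurable (by fun_prop)) ?_
  filter_upwards [ae_restrict_mem measurableSet_Ioi] with t ht
  exact (norm_rpow_mul_cexp ht _ _).le

/-- Euler's integral with a complex rate: both sides are holomorphic in `w` on the right half-plane
and agree for real `w`. -/
theorem integral_rpow_mul_cexp_neg_mul {a : ℝ} (ha : 0 < a) {w : ℂ} (hw : 0 < w.re) :
    ∫ t in Ioi (0 : ℝ), ((t ^ (a - 1) : ℝ) : ℂ) * Complex.exp (-(w * t)) =
      (1 / w) ^ (a : ℂ) * (Real.Gamma a : ℂ) := by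
  set G : ℂ → ℂ := fun w => ∫ t in Ioi (0 : ℝ), ((t ^ (a - 1) : ℝ) : ℂ) * Complex.exp (-(w * t))
  let U : Set ℂ := {w | 0 < w.re}
  have hU : IsOpen U := isOpen_lt continuous_const Complex.continuous_re
  have hconn : IsPreconnected U := (convex_halfSpace_re_gt 0).isPreconnected
  have hG : DifferentiableOn ℂ G U := by
    intro w₀ hw₀
    have hw₀' : 0 < w₀.re := hw₀
    have hV : {w : ℂ | w₀.re / 2 < w.re} ∈ 𝓝 w₀ :=
      (isOpen_lt continuous_const Complex.continuous_re).mem_nhds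
        (show w₀.re / 2 < w₀.re by linarith)
    refine DifferentiableAt.differentiableWithinAt (HasDerivAt.differentiableAt
      (hasDerivAt_integral_of_dominated_loc_of_deriv_le
      (F' := fun w t => ((t ^ (a - 1) : ℝ) : ℂ) * (Complex.exp (-(w * t)) * (-t)))
      (bound := fun t => t ^ (a + 1 - 1) * Real.exp (-(w₀.re / 2 * t)))
      hV ?_ ?_ ?_ ?_ ?_ ?_).2)
    · exact Eventually.of_forall fun w => Measurable.aestronglyMeasurable (by fun_prop)
    · exact integrableOn_rpow_mul_cexp_neg_mul ha hw₀
    · exact Measurable.aestronglyMeasurable (by fun_prop)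
    · filter_upwards [ae_restrict_mem measurableSet_Ioi] with t (ht : 0 < t) w hw
      have hw : w₀.re / 2 < w.re := hw
      rw [← mul_assoc, norm_mul, norm_rpow_mul_cexp ht, norm_neg, Complex.norm_real,
        Real.norm_of_nonneg ht.le, add_sub_right_comm, Real.rpow_add_one ht.ne', mul_right_comm]
      gcongr
    · exact integrableOn_rpow_mul_exp_neg_mul (by linarith) (by linarith)
    · filter_upwards with t w _
      have h1 : HasDerivAt (fun w : ℂ => -(w * t)) (-(t : ℂ)) w := by
        exact (((hasDerivAt_id' w).mul_const (t : ℂ)).fun_neg).congr_deriv (by simp)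
      exact h1.cexp.const_mul _
  have hR : DifferentiableOn ℂ (fun w : ℂ => (1 / w) ^ (a : ℂ) * (Real.Gamma a : ℂ)) U := by
    intro w (hw : 0 < w.re)
    have hw0 : w ≠ 0 := by rintro rfl; simp at hw
    have h1 : DifferentiableAt ℂ (fun w : ℂ => 1 / w) w :=
      (differentiableAt_const _).div differentiableAt_id hw0
    refine ((h1.cpow_const ?_).mul_const _).differentiableWithinAt
    left
    rw [one_div, Complex.inv_re]
    exact div_pos hw (Complex.normSq_pos.2 hw0)
  have hfreq : ∃ᶠ w in 𝓝[≠] (1 : ℂ), G w = (1 / w) ^ (a : ℂ) * (Real.Gamma a : ℂ) := by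
    have ht : Tendsto (fun x : ℝ => (x : ℂ)) (𝓝[≠] 1) (𝓝[≠] 1) := by
      refine tendsto_nhdsWithin_of_tendsto_nhds_of_eventually_within _ ?_ ?_
      · exact (Complex.continuous_ofReal.tendsto' 1 1 (by simp)).mono_left nhdsWithin_le_nhds
      · filter_upwards [self_mem_nhdsWithin] with x hx
        simpa using hx
    refine ht.frequently (Eventually.frequently ?_)
    have : ∀ᶠ x : ℝ in 𝓝[≠] 1, 0 < x :=
      mem_nhdsWithin_of_mem_nhds (Ioi_mem_nhds one_pos)
    filter_upwards [this] with x hx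
    have := Real.integral_rpow_mul_exp_neg_mul_Ioi ha hx
    have h2 := congrArg (fun r : ℝ => (r : ℂ)) this
    simp only [Complex.ofReal_mul] at h2
    rw [Complex.ofReal_cpow (by positivity)] at h2
    push_cast at h2 ⊢
    rw [← h2, ← integral_complex_ofReal]
    simp only [G]
    congr 1 with t
    push_cast
    rfl
  exact (hG.analyticOnNhd hU).eqOn_of_preconnected_of_frequently_eq (hR.analyticOnNhd hU) hconn
    (show (1 : ℂ) ∈ U by simp [U]) hfreq hw

/-- The Balakrishnan–Komatsu formula for the scalar operator `w`, with `Re w > 0`: write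
`(w + t) ^ (-m)` as an Euler integral and interchange the order of integration. -/
theorem integral_rpow_mul_inv_add_pow {β : ℝ} (hβ : 0 < β) {m : ℕ} (hm : β < m) {w : ℂ}
    (hw : 0 < w.re) :
    ∫ t in Ioi (0 : ℝ), ((t ^ ((m : ℝ) - β - 1) : ℝ) : ℂ) * (1 / (w + t)) ^ m =
      ((Real.Gamma β * Real.Gamma (m - β) / Real.Gamma m : ℝ) : ℂ) * (1 / w) ^ (β : ℂ) := by
  have hm0 : (0 : ℝ) < m := hβ.trans hm
  have hmβ : 0 < (m : ℝ) - β := by linarith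
  -- integrating `F` over `s` first gives the left-hand side, over `t` first the right-hand side
  let F : ℝ → ℝ → ℂ := fun t s => ((t ^ ((m : ℝ) - β - 1) : ℝ) : ℂ) *
    (((s ^ ((m : ℝ) - 1) : ℝ) : ℂ) * Complex.exp (-((w + t) * s)))
  have hF_norm : ∀ t > 0, ∀ s > 0, ‖F t s‖ = (s ^ ((m : ℝ) - 1) * Real.exp (-(w.re * s))) *
      (t ^ ((m : ℝ) - β - 1) * Real.exp (-(s * t))) := by
    intro t ht s hs
    simp only [F]
    rw [norm_mul, norm_rpow_mul_cexp hs, Complex.norm_real, Real.norm_of_nonneg (by positivity),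
      Complex.add_re, Complex.ofReal_re, add_mul, neg_add, Real.exp_add, mul_comm s t]
    ring
  have hF_s : ∀ t > 0, ∫ s in Ioi (0 : ℝ), F t s =
      (Real.Gamma m : ℂ) * (((t ^ ((m : ℝ) - β - 1) : ℝ) : ℂ) * (1 / (w + t)) ^ m) := by
    intro t ht
    simp only [F]
    rw [integral_const_mul, integral_rpow_mul_cexp_neg_mul hm0 (by simp; linarith)]
    rw [Complex.ofReal_natCast, Complex.cpow_natCast]
    ring
  have hpow : ∀ s > (0 : ℝ), s ^ ((m : ℝ) - 1) * (1 / s) ^ ((m : ℝ) - β) = s ^ (β - 1) := by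
    intro s hs
    rw [one_div, Real.inv_rpow hs.le, ← Real.rpow_neg hs.le, ← Real.rpow_add hs]
    congr 1; ring
  have hF_t : ∀ s > 0, ∫ t in Ioi (0 : ℝ), F t s =
      (Real.Gamma (m - β) : ℂ) * (((s ^ (β - 1) : ℝ) : ℂ) * Complex.exp (-(w * s))) := by
    intro s hs
    have h1 : ∀ t : ℝ, F t s = (((s ^ ((m : ℝ) - 1) : ℝ) : ℂ) * Complex.exp (-(w * s))) *
        ((t ^ ((m : ℝ) - β - 1) * Real.exp (-(s * t)) : ℝ) : ℂ) := by
      intro t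
      simp only [F]
      push_cast
      rw [add_mul, neg_add, Complex.exp_add, mul_comm (t : ℂ) s]
      ring
    simp only [h1]
    rw [integral_const_mul, integral_complex_ofReal, Real.integral_rpow_mul_exp_neg_mul_Ioi hmβ hs,
      ← hpow s hs]
    push_cast
    ring
  have hF_int : Integrable (Function.uncurry F)
      ((volume.restrict (Ioi (0 : ℝ))).prod (volume.restrict (Ioi (0 : ℝ)))) := by
    have hmeas : AEStronglyMeasurable (Function.uncurry F)
        ((volume.restrict (Ioi (0 : ℝ))).prod (volume.restrict (Ioi (0 : ℝ)))) :=
      Measurable.aestronglyMeasurable (by simp only [F, Function.uncurry_def]; fun_prop)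
    rw [integrable_prod_iff' hmeas]
    constructor
    · filter_upwards [ae_restrict_mem measurableSet_Ioi] with s (hs : 0 < s)
      refine ((integrableOn_rpow_mul_exp_neg_mul hmβ hs).const_mul
        (s ^ ((m : ℝ) - 1) * Real.exp (-(w.re * s)))).mono'
        (Measurable.aestronglyMeasurable
          (by simp only [F, Function.uncurry_def]; fun_prop)) ?_
      filter_upwards [ae_restrict_mem measurableSet_Ioi] with t (ht : 0 < t)
      exact (hF_norm t ht s hs).le
    · refine ((integrableOn_rpow_mul_exp_neg_mul hβ hw).const_mul (Real.Gamma (m - β))).congr ?_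
      filter_upwards [ae_restrict_mem measurableSet_Ioi] with s (hs : 0 < s)
      have : ∫ t in Ioi (0 : ℝ), ‖Function.uncurry F (t, s)‖ =
          ∫ t in Ioi (0 : ℝ), (s ^ ((m : ℝ) - 1) * Real.exp (-(w.re * s))) *
            (t ^ ((m : ℝ) - β - 1) * Real.exp (-(s * t))) :=
        setIntegral_congr_fun measurableSet_Ioi fun t ht => hF_norm t ht s hs
      rw [this, integral_const_mul, Real.integral_rpow_mul_exp_neg_mul_Ioi hmβ hs, ← hpow s hs]
      ring
  have hswap := integral_integral_swap hF_int
  rw [setIntegral_congr_fun measurableSet_Ioi hF_s, setIntegral_congr_fun measurableSet_Ioi hF_t,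
    integral_const_mul, integral_const_mul, integral_rpow_mul_cexp_neg_mul hβ hw] at hswap
  have hΓ : (Real.Gamma m : ℂ) ≠ 0 := by exact_mod_cast (Real.Gamma_pos_of_pos hm0).ne'
  rw [← mul_right_inj' hΓ, hswap]
  push_cast
  field_simp

/-! ### Orbits of a `C₀`-semigroup -/

section Semigroup

variable {X : Type*} [NormedAddCommGroup X] [NormedSpace ℂ X] {T : ℝ → X →L[ℂ] X}

theorem IsC0Semigroup.map_nat_mul (hT : IsC0Semigroup T) (n : ℕ) {s : ℝ} (hs : 0 ≤ s) :
    T (n * s) = T s ^ n := by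
  induction n with
  | zero => simp [hT.map_zero]
  | succ n ih =>
    rw [Nat.cast_succ, add_one_mul, hT.map_add _ _ (by positivity) hs, ih, pow_succ]

/-- Otherwise `‖T(t)‖` is unbounded along a sequence `t → 0+`, against the uniform boundedness
principle. -/
theorem IsC0Semigroup.exists_norm_le_near_zero [CompleteSpace X] (hT : IsC0Semigroup T) :
    ∃ δ > 0, ∃ C : ℝ, ∀ s ∈ Ioc 0 δ, ‖T s‖ ≤ C := by
  by_contra! h
  choose u hu hu' using fun n : ℕ => h (1 / (n + 1)) Nat.one_div_pos_of_nat n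
  have hu0 : Tendsto u atTop (𝓝[>] 0) := by
    refine tendsto_nhdsWithin_of_tendsto_nhds_of_eventually_within _ ?_
      (Eventually.of_forall fun n => (hu n).1)
    exact squeeze_zero (fun n => (hu n).1.le) (fun n => (hu n).2)
      tendsto_one_div_add_atTop_nhds_zero_nat
  obtain ⟨C, hC⟩ := banach_steinhaus (g := fun n => T (u n)) fun x => by
    obtain ⟨C, hC⟩ := ((hT.continuous_at_zero x).comp hu0).norm.bddAbove_range
    exact ⟨C, fun n => hC ⟨n, rfl⟩⟩
  obtain ⟨n, hn⟩ := exists_nat_gt C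
  exact absurd (hC n) (not_le.2 (hn.trans (hu' n)))

theorem IsC0Semigroup.exists_norm_le [CompleteSpace X] (hT : IsC0Semigroup T) (a : ℝ) :
    ∃ C : ℝ, ∀ s ∈ Icc 0 a, ‖T s‖ ≤ C := by
  obtain ⟨δ, hδ, C, hC⟩ := hT.exists_norm_le_near_zero
  obtain ⟨n, hn⟩ := exists_nat_gt (a / δ)
  refine ⟨max C 1 ^ (n + 1), fun s hs => ?_⟩
  have hn0 : (0 : ℝ) < ((n + 1 : ℕ) : ℝ) := by positivity
  have hs' : s = ((n + 1 : ℕ) : ℝ) * (s / ((n + 1 : ℕ) : ℝ)) := by field_simp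
  have hsn : 0 ≤ s / ((n + 1 : ℕ) : ℝ) := div_nonneg hs.1 hn0.le
  rw [hs', hT.map_nat_mul _ hsn]
  refine (norm_pow_le' _ n.succ_pos).trans (pow_le_pow_left₀ (norm_nonneg _) ?_ _)
  rcases hsn.eq_or_lt with h0 | h0
  · rw [← h0, hT.map_zero]
    exact ContinuousLinearMap.norm_id_le.trans (le_max_right _ _)
  · refine (hC _ ⟨h0, ?_⟩).trans (le_max_left _ _)
    rw [div_lt_iff₀ hδ] at hn
    rw [div_le_iff₀ hn0]
    push_cast
    nlinarith [hs.2]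

theorem IsC0Semigroup.continuousOn [CompleteSpace X] (hT : IsC0Semigroup T) (x : X) (a : ℝ) :
    ContinuousOn (fun t => T t x) (Icc 0 a) := by
  obtain ⟨C, hC⟩ := hT.exists_norm_le a
  have h0 : ContinuousWithinAt (fun t => T t x) (Ici 0) 0 := by
    rw [← continuousWithinAt_Ioi_iff_Ici]
    simpa [ContinuousWithinAt, hT.map_zero] using hT.continuous_at_zero x
  have hle : ∀ s ∈ Icc 0 a, ∀ t ∈ Icc 0 a, s ≤ t →
      ‖T t x - T s x‖ ≤ C * ‖T |t - s| x - x‖ := by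
    intro s hs t ht hst
    have : T t = T s * T (t - s) := by
      rw [← hT.map_add _ _ hs.1 (sub_nonneg.2 hst), add_sub_cancel]
    rw [abs_of_nonneg (sub_nonneg.2 hst), this, mul_apply_eq_comp, ← map_sub]
    exact (T s).le_of_opNorm_le (hC s hs) _
  intro s hs
  have hlim : Tendsto (fun t => C * ‖T |t - s| x - x‖) (𝓝[Icc 0 a] s) (𝓝 0) := by
    have h1 : Tendsto (fun t => |t - s|) (𝓝[Icc 0 a] s) (𝓝[≥] 0) := by
      refine tendsto_nhdsWithin_of_tendsto_nhds_of_eventually_within _ ?_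
        (Eventually.of_forall fun t => abs_nonneg (t - s))
      have : Continuous fun t : ℝ => |t - s| := by fun_prop
      exact (this.tendsto' s 0 (by simp)).mono_left nhdsWithin_le_nhds
    have h2 := (h0.tendsto.comp h1).sub_const x
    simpa [hT.map_zero] using h2.norm.const_mul C
  rw [ContinuousWithinAt, tendsto_iff_norm_sub_tendsto_zero]
  refine squeeze_zero' (Eventually.of_forall fun t => norm_nonneg _) ?_ hlim
  filter_upwards [self_mem_nhdsWithin] with t ht
  rcases le_total s t with h | h
  · exact hle s hs t ht h
  · rw [norm_sub_rev, abs_sub_comm]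
    exact hle t ht s hs h

variable {A : X →ₗ.[ℂ] X}

theorem IsC0Semigroup.hasDerivWithinAt (hT : IsC0Semigroup T) (hA : IsGenerator T A)
    (x : A.domain) {t : ℝ} (ht : 0 ≤ t) :
    HasDerivWithinAt (fun s => T s (x : X)) (T t (A x)) (Ici t) t := by
  rw [← hasDerivWithinAt_Ioi_iff_Ici, hasDerivWithinAt_iff_tendsto_slope' self_notMem_Ioi]
  have h0 := (hA x (A x)).1 (A.mem_graph x)
  have h1 : Tendsto (fun s => s - t) (𝓝[>] t) (𝓝[>] 0) := by
    refine tendsto_nhdsWithin_of_tendsto_nhds_of_eventually_within _ ?_ ?_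
    · have : Continuous fun s : ℝ => s - t := by fun_prop
      exact (this.tendsto' t 0 (by simp)).mono_left nhdsWithin_le_nhds
    · filter_upwards [self_mem_nhdsWithin] with s hs
      exact sub_pos.2 (mem_Ioi.1 hs)
  refine (((T t).continuous.tendsto _).comp (h0.comp h1)).congr' ?_
  filter_upwards [self_mem_nhdsWithin] with s (hs : t < s)
  have : T s = T t * T (s - t) := by
    rw [← hT.map_add _ _ ht (sub_pos.2 hs).le, add_sub_cancel]
  simp only [Function.comp_apply, slope_def_module, map_smul, map_sub, this,
    mul_apply_eq_comp]
  rw [← Complex.ofReal_inv, Complex.coe_smul]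

/-- An approximate eigenvector of the generator is an approximate eigenvector of `T a`: the curve
`s ↦ e ^ (-s z) T(s) x` has right derivative `e ^ (-s z) T(s) (A x - z x)`. -/
theorem IsC0Semigroup.exists_norm_sub_exp_smul_le [CompleteSpace X] (hT : IsC0Semigroup T)
    (hA : IsGenerator T A) {a : ℝ} (ha : 0 ≤ a) (z : ℂ) :
    ∃ C ≥ 0, ∀ x : A.domain,
      ‖T a (x : X) - Complex.exp (a * z) • (x : X)‖ ≤ C * ‖A x - z • (x : X)‖ := by
  obtain ⟨C, hC⟩ := hT.exists_norm_le a
  have hC0 : 0 ≤ C := (norm_nonneg _).trans (hC 0 ⟨le_rfl, ha⟩)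
  refine ⟨‖Complex.exp (a * z)‖ * (Real.exp (a * ‖z‖) * C * a), by positivity, fun x => ?_⟩
  let f : ℝ → X := fun s => Complex.exp (-(s * z)) • T s (x : X)
  have hexp : ∀ s : ℝ, HasDerivAt (fun s : ℝ => Complex.exp (-(s * z)))
      (Complex.exp (-(s * z)) * -z) s := by
    intro s
    have h1 : HasDerivAt (fun s : ℝ => -((s : ℂ) * z)) (-z) s :=
      ((Complex.ofRealCLM.hasDerivAt (x := s)).mul_const z).fun_neg.congr_deriv (by simp)
    exact h1.cexp
  have hf : ContinuousOn f (Icc 0 a) :=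
    ContinuousOn.smul (by fun_prop) (hT.continuousOn x a)
  have hf' : ∀ s ∈ Ico 0 a, HasDerivWithinAt f
      (Complex.exp (-(s * z)) • T s (A x - z • (x : X))) (Ici s) s := by
    intro s hs
    refine ((hexp s).hasDerivWithinAt.smul (hT.hasDerivWithinAt hA x hs.1)).congr_deriv ?_
    rw [map_sub, map_smul, smul_sub, smul_smul, mul_neg, neg_smul, sub_eq_add_neg]
  have hbound : ∀ s ∈ Ico 0 a, ‖Complex.exp (-(s * z)) • T s (A x - z • (x : X))‖ ≤
      Real.exp (a * ‖z‖) * C * ‖A x - z • (x : X)‖ := by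
    intro s hs
    rw [norm_smul, mul_assoc]
    gcongr
    · rw [Complex.norm_exp]
      gcongr
      refine (Complex.re_le_norm _).trans ?_
      rw [norm_neg, norm_mul, Complex.norm_real, Real.norm_of_nonneg hs.1]
      gcongr
      exact hs.2.le
    · exact (T s).le_of_opNorm_le (hC s ⟨hs.1, hs.2.le⟩) _
  have h := norm_image_sub_le_of_norm_deriv_right_le_segment hf hf' hbound a ⟨ha, le_rfl⟩
  have h2 : T a (x : X) - Complex.exp (a * z) • (x : X) =
      Complex.exp (a * z) • (f a - f 0) := by
    simp only [f, smul_sub, smul_smul, ← Complex.exp_add]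
    simp [hT.map_zero]
  rw [h2, norm_smul, mul_assoc]
  gcongr
  linarith

end Semigroup

/-! ### Approximate eigenvectors from a functional calculus -/

section Calculus

variable {X : Type*} [NormedAddCommGroup X] [NormedSpace ℂ X]

/-- The coordinate function `z ↦ z` on `K ⊆ ℂ`. -/
def coordinate (K : Set ℂ) : C(K, ℂ) := ⟨fun z => z, continuous_subtype_val⟩

@[simp]
theorem coordinate_apply (K : Set ℂ) (z : K) : coordinate K z = z := rfl

/-- `Φ` is a contractive injective functional calculus on the compact set `K` for the bounded
operator `(-A)⁻¹ = R(0, A)`. -/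
structure IsInverseCalculus (A : X →ₗ.[ℂ] X) (K : Set ℂ) [CompactSpace K]
    (Φ : C(K, ℂ) →ₐ[ℂ] (X →L[ℂ] X)) : Prop where
  norm_le : ∀ f, ‖Φ f‖ ≤ ‖f‖
  injective : Function.Injective Φ
  isResolventAt_zero : A.IsResolventAt 0 (Φ (coordinate K))

/-- Every point of `K` is a joint approximate eigenvalue: take a vector in the range of `Φ f`, where
`f` is a bump function near the point. A second bump function that is `1` on the support of `f`
makes the estimate independent of the norm of `Φ f`. -/
theorem exists_approx_eigenvector {K : Set ℂ} [CompactSpace K] {Φ : C(K, ℂ) →ₐ[ℂ] (X →L[ℂ] X)}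
    (hnorm : ∀ f, ‖Φ f‖ ≤ ‖f‖) (hinj : Function.Injective Φ) (l : K) (g₁ g₂ : C(K, ℂ)) {ε : ℝ}
    (hε : 0 < ε) :
    ∃ y : X, y ≠ 0 ∧ ‖Φ g₁ y - g₁ l • y‖ ≤ ε * ‖y‖ ∧ ‖Φ g₂ y - g₂ l • y‖ ≤ ε * ‖y‖ := by
  have hU : ∀ᶠ z in 𝓝 l, ‖g₁ z - g₁ l‖ < ε ∧ ‖g₂ z - g₂ l‖ < ε := by
    have h (g : C(K, ℂ)) : ∀ᶠ z in 𝓝 l, ‖g z - g l‖ < ε := by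
      have := Metric.tendsto_nhds.1 (g.continuous.tendsto l) ε hε
      simpa only [dist_eq_norm] using this
    exact (h g₁).and (h g₂)
  obtain ⟨r, hr, hball⟩ := Metric.eventually_nhds_iff.1 hU
  -- `f` is supported in the ball of radius `r / 2`, on which `f₁ = 1`; `f₁` in that of radius `r`
  let f : C(K, ℂ) := ⟨fun z => ((max 0 (r / 2 - dist z l) : ℝ) : ℂ), by fun_prop⟩
  let f₁ : C(K, ℂ) := ⟨fun z => ((min 1 (max 0 (2 - 2 / r * dist z l)) : ℝ) : ℂ), by fun_prop⟩
  have hff : f₁ * f = f := by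
    ext z
    simp only [f, f₁, ContinuousMap.mul_apply, ContinuousMap.coe_mk]
    rcases le_total (r / 2) (dist z l) with h | h
    · simp [max_eq_left (sub_nonpos.2 h)]
    · have : (1 : ℝ) ≤ 2 - 2 / r * dist z l := by
        have : 2 / r * dist z l ≤ 2 / r * (r / 2) := by gcongr
        have h2 : 2 / r * (r / 2) = 1 := by field_simp
        linarith
      rw [min_eq_left (this.trans (le_max_right _ _))]
      simp
  have hf0 : f ≠ 0 := by
    intro h
    have := DFunLike.congr_fun h l
    simp only [f, ContinuousMap.coe_mk, dist_self, ContinuousMap.zero_apply, sub_zero,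
      Complex.ofReal_eq_zero] at this
    rw [max_eq_right (by positivity)] at this
    linarith
  obtain ⟨x, hx⟩ : ∃ x, Φ f x ≠ 0 := by
    by_contra! h
    exact hf0 (hinj (by rw [map_zero]; ext x; simp [h x]))
  have key (g : C(K, ℂ)) (hg : ∀ z, dist z l < r → ‖g z - g l‖ < ε) :
      ‖Φ g (Φ f x) - g l • Φ f x‖ ≤ ε * ‖Φ f x‖ := by
    have h1 : Φ g (Φ f x) - g l • Φ f x = Φ ((g - algebraMap ℂ _ (g l)) * f₁) (Φ f x) := by
      rw [← mul_apply_eq_comp (Φ (_ * f₁)), ← map_mul, mul_assoc, hff, sub_mul, map_sub,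
        map_mul, map_mul, AlgHom.commutes, Algebra.algebraMap_eq_smul_one]
      simp
    rw [h1]
    refine (Φ _).le_of_opNorm_le ((hnorm _).trans ?_) _
    rw [ContinuousMap.norm_le _ hε.le]
    intro z
    rw [ContinuousMap.mul_apply, norm_mul]
    have h2 : ‖f₁ z‖ = min 1 (max 0 (2 - 2 / r * dist z l)) := by
      simp only [f₁, ContinuousMap.coe_mk, Complex.norm_real]
      exact Real.norm_of_nonneg (le_min zero_le_one (le_max_left _ _))
    rw [h2]
    rcases lt_or_ge (dist z l) r with h | h
    · exact (mul_le_of_le_one_right (norm_nonneg _) (min_le_left _ _)).trans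
        (by simpa using (hg z h).le)
    · have h3 : 2 / r * r ≤ 2 / r * dist z l := by gcongr
      have h4 : 2 / r * r = 2 := by field_simp
      rw [max_eq_left (by linarith)]
      simp [hε.le]
  exact ⟨Φ f x, hx, key g₁ fun z hz => (hball hz).1, key g₂ fun z hz => (hball hz).2⟩

variable {K : Set ℂ} [CompactSpace K] {Φ : C(K, ℂ) →ₐ[ℂ] (X →L[ℂ] X)} {A : X →ₗ.[ℂ] X}
  {T : ℝ → X →L[ℂ] X}

theorem LinearPMap.IsResolventAt.mem_domain {z : ℂ} {B : X →L[ℂ] X} (hB : A.IsResolventAt z B)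
    (x : X) : B x ∈ A.domain :=
  (hB.1 x).1

theorem LinearPMap.IsResolventAt.map_apply_zero {B : X →L[ℂ] X} (hB : A.IsResolventAt 0 B)
    (x : X) : A ⟨B x, hB.mem_domain x⟩ = -x := by
  obtain ⟨h, h'⟩ := hB.1 x
  rw [zero_smul, zero_sub] at h'
  rw [← neg_eq_iff_eq_neg, h']

/-- The spectral lower bound for `T(t) Φ(q)`: the point `l ≠ 0` of `K` corresponds to the
approximate eigenvalue `-1 / l` of `A`. -/
theorem IsInverseCalculus.norm_exp_mul_norm_le [CompleteSpace X] (hΦ : IsInverseCalculus A K Φ)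
    (hT : IsC0Semigroup T) (hA : IsGenerator T A) {l : K} (hl : (l : ℂ) ≠ 0) (q : C(K, ℂ)) {t : ℝ}
    (ht : 0 ≤ t) :
    ‖Complex.exp (t * -(l : ℂ)⁻¹)‖ * ‖q l‖ ≤ ‖T t * Φ q‖ := by
  obtain ⟨C, hC0, hC⟩ := hT.exists_norm_sub_exp_smul_le hA ht (-(l : ℂ)⁻¹)
  set e := Complex.exp (t * -(l : ℂ)⁻¹)
  set B := Φ (coordinate K)
  set D : ℝ := ‖(l : ℂ)‖ * ‖T t‖ + ‖q l‖ * ‖T t‖ + ‖q l‖ * (C * ‖(l : ℂ)‖⁻¹) + ‖e‖ * ‖q l‖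
  have hl' : 0 < ‖(l : ℂ)‖ := norm_pos_iff.2 hl
  have hD : 0 ≤ D := by positivity
  have key : ∀ ε > 0, ‖(l : ℂ)‖ * (‖e‖ * ‖q l‖) ≤ ‖(l : ℂ)‖ * ‖T t * Φ q‖ + D * ε := by
    intro ε hε
    obtain ⟨y, hy, h₁, h₂⟩ :=
      exists_approx_eigenvector hΦ.norm_le hΦ.injective l (coordinate K) q hε
    rw [coordinate_apply] at h₁
    have hy' : 0 < ‖y‖ := norm_pos_iff.2 hy
    have h₃ : ‖T t (B y) - e • B y‖ ≤ C * ‖(l : ℂ)‖⁻¹ * (ε * ‖y‖) := by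
      refine (hC ⟨B y, hΦ.isResolventAt_zero.mem_domain y⟩).trans ?_
      have : -y - -(l : ℂ)⁻¹ • B y = (l : ℂ)⁻¹ • (B y - (l : ℂ) • y) := by
        rw [smul_sub, smul_smul, inv_mul_cancel₀ hl, one_smul, neg_smul]
        abel
      rw [hΦ.isResolventAt_zero.map_apply_zero, this, norm_smul, norm_inv, mul_assoc]
      gcongr
    -- telescoping `T(t) Φ(q) l y ≈ q(l) T(t) l y ≈ q(l) T(t) B y ≈ q(l) e B y ≈ q(l) e l y`
    have h₄ : ((l : ℂ) * (e * q l)) • y = (l : ℂ) • (T t * Φ q) y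
        - (l : ℂ) • T t (Φ q y - q l • y) + q l • T t (B y - (l : ℂ) • y)
        - q l • (T t (B y) - e • B y) - (e * q l) • (B y - (l : ℂ) • y) := by
      simp only [map_sub, map_smul, mul_apply_eq_comp]
      module
    have h₅ := congrArg norm h₄
    rw [norm_smul, norm_mul, norm_mul] at h₅
    have h₆ : ‖(l : ℂ)‖ * (‖e‖ * ‖q l‖) * ‖y‖ ≤
        (‖(l : ℂ)‖ * ‖T t * Φ q‖ + D * ε) * ‖y‖ := by
      rw [h₅]
      refine (norm_sub_le _ _).trans ((add_le_add_left ((norm_sub_le _ _).trans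
        (add_le_add_left ((norm_add_le _ _).trans (add_le_add_left (norm_sub_le _ _) _)) _))
        _).trans ?_)
      simp only [norm_smul, norm_mul]
      have e1 := (T t * Φ q).le_opNorm y
      have e2 := (T t).le_opNorm_of_le h₂
      have e3 := (T t).le_opNorm_of_le h₁
      calc _ ≤ ‖(l : ℂ)‖ * (‖T t * Φ q‖ * ‖y‖) + ‖(l : ℂ)‖ * (‖T t‖ * (ε * ‖y‖)) +
            ‖q l‖ * (‖T t‖ * (ε * ‖y‖)) + ‖q l‖ * (C * ‖(l : ℂ)‖⁻¹ * (ε * ‖y‖)) +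
            ‖e‖ * ‖q l‖ * (ε * ‖y‖) := by gcongr
        _ = _ := by simp only [D]; ring
    exact le_of_mul_le_mul_right h₆ hy'
  refine le_of_mul_le_mul_left (le_of_forall_pos_le_add fun δ hδ => ?_) hl'
  refine (key (δ / (D + 1)) (by positivity)).trans ?_
  gcongr
  rw [mul_div_assoc', div_le_iff₀ (by positivity)]
  nlinarith

end Calculus

/-! ### Resolvents, Cayley transform and fractional powers in the calculus -/

section Symbols

variable {K : Set ℂ}

theorem re_nonneg_of_sector (hK : ∀ z ∈ K, z = 0 ∨ 0 < z.re) {z : ℂ} (hz : z ∈ K) : 0 ≤ z.re := by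
  rcases hK z hz with rfl | h
  · simp
  · exact h.le

theorem one_le_norm_one_add_mul {t : ℝ} (ht : 0 ≤ t) {z : ℂ} (hz : 0 ≤ z.re) :
    1 ≤ ‖1 + (t : ℂ) * z‖ := by
  refine le_trans ?_ (Complex.re_le_norm _)
  simp only [Complex.add_re, Complex.one_re, Complex.re_ofReal_mul]
  nlinarith [mul_nonneg ht hz]

theorem mul_norm_le_norm_one_add_mul {t : ℝ} (ht : 0 ≤ t) {z : ℂ} (hz : 0 ≤ z.re) :
    t * ‖z‖ ≤ ‖1 + (t : ℂ) * z‖ := by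
  have h : ‖(t : ℂ) * z‖ ≤ ‖1 + (t : ℂ) * z‖ := by
    rw [Complex.norm_def, Complex.norm_def]
    gcongr
    simp only [Complex.normSq_apply, Complex.add_re, Complex.one_re, Complex.re_ofReal_mul,
      Complex.add_im, Complex.one_im, zero_add]
    nlinarith [mul_nonneg ht hz]
  rwa [norm_mul, Complex.norm_real, Real.norm_of_nonneg ht] at h

/-- The symbol `z / (1 + |t| z) = (|t| + 1 / z)⁻¹` of the resolvent `R(|t|, A)`, as a function of
the spectral parameter `z` of `(-A)⁻¹`. The absolute value makes it continuous on `K` for all real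
`t`. -/
noncomputable def resolventSymbol (hK : ∀ z ∈ K, z = 0 ∨ 0 < z.re) (t : ℝ) : C(K, ℂ) where
  toFun z := z / (1 + (|t| : ℝ) * z)
  continuous_toFun := by
    refine Continuous.div (by fun_prop) (by fun_prop) fun z h => ?_
    have := one_le_norm_one_add_mul (abs_nonneg t) (re_nonneg_of_sector hK z.2)
    rw [h, norm_zero] at this
    linarith

/-- The symbol `z ^ β` of `(-A) ^ (-β)`, as a function of the spectral parameter `z` of
`(-A)⁻¹`. -/
noncomputable def powSymbol (hK : ∀ z ∈ K, z = 0 ∨ 0 < z.re) {β : ℝ} (hβ : 0 < β) : C(K, ℂ) where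
  toFun z := (z : ℂ) ^ (β : ℂ)
  continuous_toFun := by
    refine continuous_iff_continuousAt.2 fun z => ?_
    refine ContinuousAt.comp (g := fun z : ℂ => z ^ (β : ℂ)) ?_ continuous_subtype_val.continuousAt
    rcases hK z z.2 with h | h
    · rw [h]
      exact Complex.continuousAt_cpow_const_of_re_pos (Or.inl (by simp)) (by simpa using hβ)
    · exact continuousAt_cpow_const (Or.inl h)

variable (hK : ∀ z ∈ K, z = 0 ∨ 0 < z.re)

theorem resolventSymbol_apply {t : ℝ} (ht : 0 ≤ t) (z : K) :
    resolventSymbol hK t z = z / (1 + t * z) := by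
  simp [resolventSymbol, abs_of_nonneg ht]

theorem norm_powSymbol_apply {β : ℝ} (hβ : 0 < β) (z : K) : ‖powSymbol hK hβ z‖ = ‖(z : ℂ)‖ ^ β :=
  Complex.norm_cpow_real _ _

theorem one_add_mul_ne_zero {t : ℝ} (ht : 0 ≤ t) {z : ℂ} (hz : 0 ≤ z.re) :
    1 + (t : ℂ) * z ≠ 0 :=
  norm_pos_iff.1 (one_pos.trans_le (one_le_norm_one_add_mul ht hz))

theorem coordinate_eq_resolventSymbol {t : ℝ} (ht : 0 ≤ t) :
    resolventSymbol hK t + (t : ℂ) • (coordinate K * resolventSymbol hK t) = coordinate K := by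
  ext z
  have := one_add_mul_ne_zero ht (re_nonneg_of_sector hK z.2)
  simp only [ContinuousMap.add_apply, ContinuousMap.smul_apply, ContinuousMap.mul_apply,
    coordinate_apply, resolventSymbol_apply hK ht, smul_eq_mul]
  rw [← mul_assoc, mul_div_assoc', ← add_div, div_eq_iff this]
  ring

variable [CompactSpace K]

theorem norm_resolventSymbol_le (t : ℝ) : ‖resolventSymbol hK t‖ ≤ ‖coordinate K‖ := by
  rw [ContinuousMap.norm_le _ (norm_nonneg _)]
  intro z
  have h1 := one_le_norm_one_add_mul (abs_nonneg t) (re_nonneg_of_sector hK z.2)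
  simp only [resolventSymbol, ContinuousMap.coe_mk, norm_div]
  exact (div_le_self (norm_nonneg _) h1).trans ((coordinate K).norm_coe_le_norm z)

theorem norm_resolventSymbol_le_inv {t : ℝ} (ht : 0 < t) : ‖resolventSymbol hK t‖ ≤ t⁻¹ := by
  rw [ContinuousMap.norm_le _ (by positivity)]
  intro z
  have h1 := one_le_norm_one_add_mul ht.le (re_nonneg_of_sector hK z.2)
  have h2 := mul_norm_le_norm_one_add_mul ht.le (re_nonneg_of_sector hK z.2)
  rw [resolventSymbol_apply hK ht.le, norm_div, div_le_iff₀ (by linarith), ← div_eq_inv_mul,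
    le_div_iff₀' ht]
  exact h2

theorem continuousOn_resolventSymbol : ContinuousOn (resolventSymbol hK) (Ioi 0) := by
  have hlip : LipschitzOnWith (‖coordinate K‖₊ * ‖coordinate K‖₊) (resolventSymbol hK) (Ioi 0) := by
    refine LipschitzOnWith.of_dist_le_mul fun s (hs : 0 < s) t (ht : 0 < t) => ?_
    have h : resolventSymbol hK s - resolventSymbol hK t =
        ((t - s : ℝ) : ℂ) • (resolventSymbol hK s * resolventSymbol hK t) := by
      ext z
      have h1 := one_add_mul_ne_zero hs.le (re_nonneg_of_sector hK z.2)
      have h2 := one_add_mul_ne_zero ht.le (re_nonneg_of_sector hK z.2)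
      simp only [ContinuousMap.sub_apply, ContinuousMap.smul_apply, ContinuousMap.mul_apply,
        resolventSymbol_apply hK hs.le, resolventSymbol_apply hK ht.le, smul_eq_mul]
      rw [div_sub_div _ _ h1 h2, div_mul_div_comm, mul_div_assoc']
      push_cast
      congr 1
      ring
    rw [dist_eq_norm, h, norm_smul, Complex.norm_real, dist_comm, Real.dist_eq, mul_comm,
      Real.norm_eq_abs]
    gcongr
    exact (norm_mul_le _ _).trans (mul_le_mul (norm_resolventSymbol_le hK s)
      (norm_resolventSymbol_le hK t) (norm_nonneg _) (norm_nonneg _))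
  exact hlip.continuousOn

/-- The Balakrishnan–Komatsu integral converges absolutely already in `C(K)`: the resolvent symbols
are bounded near `0` and decay like `1 / t` at infinity. -/
theorem integrableOn_rpow_smul_resolventSymbol_pow {β : ℝ} (hβ : 0 < β) {m : ℕ} (hm : β < m) :
    IntegrableOn (fun t : ℝ => t ^ ((m : ℝ) - β - 1) • resolventSymbol hK t ^ m) (Ioi 0) := by
  have hmeas : AEStronglyMeasurable
      (fun t : ℝ => t ^ ((m : ℝ) - β - 1) • resolventSymbol hK t ^ m)
      (volume.restrict (Ioi 0)) := by
    refine ContinuousOn.aestronglyMeasurable ?_ measurableSet_Ioi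
    have h1 : ContinuousOn (fun t : ℝ => t ^ ((m : ℝ) - β - 1)) (Ioi 0) := fun t ht =>
      (Real.continuousAt_rpow_const _ _ (Or.inl (ne_of_gt ht))).continuousWithinAt
    exact h1.smul ((continuousOn_resolventSymbol hK).pow m)
  have hm0 : 0 < m := by exact_mod_cast hβ.trans hm
  rw [← Ioc_union_Ioi_eq_Ioi zero_le_one, integrableOn_union]
  constructor
  · have h1 : IntegrableOn (fun t : ℝ => t ^ ((m : ℝ) - β - 1) * ‖coordinate K‖ ^ m) (Ioc 0 1) :=
      Integrable.mul_const ((intervalIntegrable_iff_integrableOn_Ioc_of_le zero_le_one).1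
        (intervalIntegral.intervalIntegrable_rpow' (by linarith))) _
    refine h1.mono' (hmeas.mono_measure (Measure.restrict_mono Ioc_subset_Ioi_self le_rfl)) ?_
    filter_upwards [ae_restrict_mem measurableSet_Ioc] with t ht
    have ht0 : 0 ≤ t := ht.1.le
    rw [norm_smul, Real.norm_of_nonneg (by positivity)]
    gcongr
    exact (norm_pow_le' _ hm0).trans (pow_le_pow_left₀ (norm_nonneg _)
      (norm_resolventSymbol_le hK t) _)
  · have h1 : IntegrableOn (fun t : ℝ => t ^ (-β - 1)) (Ioi 1) :=
      integrableOn_Ioi_rpow_of_lt (by linarith) one_pos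
    refine h1.mono' (hmeas.mono_measure
      (Measure.restrict_mono (Ioi_subset_Ioi zero_le_one) le_rfl)) ?_
    filter_upwards [ae_restrict_mem measurableSet_Ioi] with t ht
    have ht0 : 0 < t := one_pos.trans ht
    have h2 : t ^ (-β - 1) = t ^ ((m : ℝ) - β - 1) * t⁻¹ ^ m := by
      rw [inv_pow, ← Real.rpow_natCast, ← Real.rpow_neg ht0.le, ← Real.rpow_add ht0]
      congr 1
      ring
    rw [norm_smul, Real.norm_of_nonneg (by positivity), h2]
    gcongr
    exact (norm_pow_le' _ hm0).trans (pow_le_pow_left₀ (norm_nonneg _)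
      (norm_resolventSymbol_le_inv hK ht0) _)

theorem integral_rpow_smul_resolventSymbol_pow {β : ℝ} (hβ : 0 < β) {m : ℕ} (hm : β < m) :
    ∫ t in Ioi (0 : ℝ), t ^ ((m : ℝ) - β - 1) • resolventSymbol hK t ^ m =
      (Real.Gamma β * Real.Gamma (m - β) / Real.Gamma m) • powSymbol hK hβ := by
  ext z
  have h := (ContinuousMap.evalCLM ℂ z).integral_comp_comm
    (integrableOn_rpow_smul_resolventSymbol_pow hK hβ hm)
  have hm0 : m ≠ 0 := by rintro rfl; simp at hm; linarith
  simp only [ContinuousMap.evalCLM_apply] at h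
  rw [← h, ContinuousMap.smul_apply, Complex.real_smul]
  rcases hK z z.2 with h0 | h0
  · rw [setIntegral_congr_fun (g := fun _ => 0) measurableSet_Ioi]
    · simp [powSymbol, h0, hβ.ne']
    · intro t ht
      simp [resolventSymbol, h0, hm0]
  · have hz : (z : ℂ) ≠ 0 := by intro h; simp [h] at h0
    have hw : 0 < ((z : ℂ)⁻¹).re := by
      rw [Complex.inv_re]
      exact div_pos h0 (Complex.normSq_pos.2 hz)
    have h1 := integral_rpow_mul_inv_add_pow hβ hm hw
    rw [one_div, inv_inv] at h1
    rw [show powSymbol hK hβ z = (z : ℂ) ^ (β : ℂ) from rfl, ← h1]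
    refine setIntegral_congr_fun measurableSet_Ioi fun t (ht : 0 < t) => ?_
    have h2 := one_add_mul_ne_zero ht.le h0.le
    have h3 : (z : ℂ) / (1 + t * z) = 1 / ((z : ℂ)⁻¹ + t) := by
      rw [show (z : ℂ)⁻¹ + t = (1 + t * z) / z by field_simp, one_div_div]
    simp only [ContinuousMap.smul_apply, ContinuousMap.pow_apply,
      resolventSymbol_apply hK ht.le, h3, Complex.real_smul]

end Symbols

section Calculus

variable {X : Type*} [NormedAddCommGroup X] [NormedSpace ℂ X]
  {A : X →ₗ.[ℂ] X} {T : ℝ → X →L[ℂ] X}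

/-- The two relations `R + t B R = B = R + t R B` characterise `R = R(t, A)` in terms of
`B = R(0, A)`. -/
theorem LinearPMap.IsResolventAt.of_zero {B R : X →L[ℂ] X} {t : ℂ} (hB : A.IsResolventAt 0 B)
    (h₁ : R + t • (B * R) = B) (h₂ : R + t • (R * B) = B) : A.IsResolventAt t R := by
  have h₁' (x : X) : R x = B (x - t • R x) := by
    have := DFunLike.congr_fun h₁ x
    simp only [_root_.add_apply, _root_.smul_apply,
      mul_apply_eq_comp] at this
    rw [B.map_sub, B.map_smul, ← this, add_sub_cancel_right]
  have hmem (x : X) : R x ∈ A.domain := by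
    rw [h₁']
    exact hB.mem_domain _
  refine ⟨fun x => ⟨hmem x, ?_⟩, fun y => ?_⟩
  · have : (⟨R x, hmem x⟩ : A.domain) = ⟨B (x - t • R x), hB.mem_domain _⟩ :=
      Subtype.ext (h₁' x)
    rw [this, hB.map_apply_zero]
    abel
  · have hy := hB.2 y
    rw [zero_smul, zero_sub] at hy
    have := DFunLike.congr_fun h₂ (-A y)
    simp only [_root_.add_apply, _root_.smul_apply,
      mul_apply_eq_comp, hy] at this
    rw [sub_eq_neg_add, R.map_add, R.map_smul, this]

variable {K : Set ℂ} [CompactSpace K] {Φ : C(K, ℂ) →ₐ[ℂ] (X →L[ℂ] X)}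
  (hK : ∀ z ∈ K, z = 0 ∨ 0 < z.re)

theorem algHom_map_real_smul (c : ℝ) (f : C(K, ℂ)) : Φ (c • f) = c • Φ f := by
  rw [← Complex.coe_smul, ← Complex.coe_smul, map_smul]

theorem IsInverseCalculus.isResolventAt (hΦ : IsInverseCalculus A K Φ) {t : ℝ} (ht : 0 ≤ t) :
    A.IsResolventAt t (Φ (resolventSymbol hK t)) := by
  have h := congrArg Φ (coordinate_eq_resolventSymbol hK ht)
  refine hΦ.isResolventAt_zero.of_zero ?_ ?_
  · rwa [map_add, map_smul, map_mul] at h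
  · rwa [map_add, map_smul, mul_comm, map_mul] at h

theorem IsInverseCalculus.mem_resolventSet (hΦ : IsInverseCalculus A K Φ)
    (hK : ∀ z ∈ K, z = 0 ∨ 0 < z.re) {t : ℝ} (ht : 0 ≤ t) :
    (t : ℂ) ∈ A.resolventSet :=
  ⟨_, hΦ.isResolventAt hK ht⟩

theorem IsInverseCalculus.cayley_eq (hΦ : IsInverseCalculus A K Φ) :
    A.cayley = Φ ((2 : ℂ) • resolventSymbol hK 1 - 1) := by
  have h1 := hΦ.isResolventAt hK zero_le_one
  have h1' := hΦ.mem_resolventSet hK zero_le_one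
  rw [Complex.ofReal_one] at h1 h1'
  rw [LinearPMap.cayley_eq h1', h1.eq_resolvent, map_sub, map_smul, map_one]

theorem IsInverseCalculus.negFracPowIntegrand_eq (hΦ : IsInverseCalculus A K Φ) (β : ℝ) {t : ℝ}
    (ht : 0 ≤ t) :
    A.negFracPowIntegrand β t =
      Φ (t ^ (((⌊β⌋₊ + 1 : ℕ) : ℝ) - β - 1) • resolventSymbol hK t ^ (⌊β⌋₊ + 1)) := by
  rw [LinearPMap.negFracPowIntegrand, (hΦ.isResolventAt hK ht).eq_resolvent,
    algHom_map_real_smul, map_pow]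

/-- The calculus as a bounded linear map, so that it commutes with Bochner integrals. -/
noncomputable def IsInverseCalculus.toCLM (hΦ : IsInverseCalculus A K Φ) :
    C(K, ℂ) →L[ℂ] (X →L[ℂ] X) :=
  Φ.toLinearMap.mkContinuous 1 fun f => by simpa using hΦ.norm_le f

theorem IsInverseCalculus.negFracPowExists (hΦ : IsInverseCalculus A K Φ)
    (hK : ∀ z ∈ K, z = 0 ∨ 0 < z.re) {β : ℝ} (hβ : 0 < β) :
    A.NegFracPowExists β := by
  refine ⟨fun t ht => hΦ.mem_resolventSet hK ht, ?_⟩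
  have hm : β < ((⌊β⌋₊ + 1 : ℕ) : ℝ) := by exact_mod_cast Nat.lt_floor_add_one β
  exact (integrableOn_congr_fun (fun t (ht : 0 < t) => hΦ.negFracPowIntegrand_eq hK β ht.le)
    measurableSet_Ioi).2
    (hΦ.toCLM.integrable_comp (integrableOn_rpow_smul_resolventSymbol_pow hK hβ hm))

theorem IsInverseCalculus.negFracPow_eq [CompleteSpace X] (hΦ : IsInverseCalculus A K Φ) {β : ℝ}
    (hβ : 0 < β) : A.negFracPow β = Φ (powSymbol hK hβ) := by
  have hm : β < ((⌊β⌋₊ + 1 : ℕ) : ℝ) := by exact_mod_cast Nat.lt_floor_add_one β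
  have h := hΦ.toCLM.integral_comp_comm (integrableOn_rpow_smul_resolventSymbol_pow hK hβ hm)
  rw [integral_rpow_smul_resolventSymbol_pow hK hβ hm] at h
  have h2 := setIntegral_congr_fun (μ := volume) measurableSet_Ioi
    fun t (ht : 0 < t) => hΦ.negFracPowIntegrand_eq hK β ht.le
  rw [LinearPMap.negFracPow, h2]
  change _ • ∫ t in Ioi (0 : ℝ), hΦ.toCLM _ = _
  rw [h]
  change _ • Φ _ = _
  rw [algHom_map_real_smul, smul_smul]
  have h3 := Real.Gamma_pos_of_pos (hβ.trans hm)
  have h4 := Real.Gamma_pos_of_pos hβ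
  have h5 := Real.Gamma_pos_of_pos (sub_pos.2 hm)
  rw [div_mul_div_cancel₀ (mul_pos h4 h5).ne', div_self h3.ne', one_smul]

end Calculus

/-! ### Rates of decay -/

/-- With `y = 2 Re z / |1 + z| ^ 2`, the Cayley symbol has modulus `(1 - 2 y) ^ (1 / 2) ≤ e ^ (-y)`,
and `n y e ^ (-n y) ≤ 1`. -/
theorem nat_mul_norm_cayley_pow_mul_re_le (n : ℕ) {z : ℂ} (hz : 0 ≤ z.re) :
    n * ‖2 * (z / (1 + z)) - 1‖ ^ n * z.re ≤ ‖1 + z‖ ^ 2 := by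
  have h1 : 1 ≤ ‖1 + z‖ := by simpa using one_le_norm_one_add_mul zero_le_one hz
  have h0 : 1 + z ≠ 0 := norm_pos_iff.1 (by linarith)
  set y := 2 * z.re / ‖1 + z‖ ^ 2
  have hy : 0 ≤ y := by positivity
  have hsq : ‖z - 1‖ ^ 2 = ‖1 + z‖ ^ 2 - 4 * z.re := by
    rw [Complex.sq_norm, Complex.sq_norm, Complex.normSq_apply, Complex.normSq_apply]
    simp only [Complex.sub_re, Complex.sub_im, Complex.add_re, Complex.add_im, Complex.one_re,
      Complex.one_im]
    ring
  have hc : ‖2 * (z / (1 + z)) - 1‖ ≤ Real.exp (-y) := by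
    have h2 : 2 * (z / (1 + z)) - 1 = (z - 1) / (1 + z) := by
      field_simp
      ring
    have h3 : ‖2 * (z / (1 + z)) - 1‖ ^ 2 = 1 - 2 * y := by
      rw [h2, norm_div, div_pow, hsq]
      simp only [y]
      field_simp
      ring
    refine le_of_sq_le_sq ?_ (Real.exp_pos _).le
    rw [h3, ← Real.exp_nat_mul]
    have := Real.add_one_le_exp (-(2 * y))
    push_cast
    rw [mul_neg]
    linarith
  have hn : n * y * ‖2 * (z / (1 + z)) - 1‖ ^ n ≤ 1 := by
    calc n * y * ‖2 * (z / (1 + z)) - 1‖ ^ n ≤ Real.exp (n * y) * Real.exp (-y) ^ n := by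
          gcongr
          linarith [Real.add_one_le_exp (n * y)]
      _ = 1 := by rw [← Real.exp_nat_mul, ← Real.exp_add]; simp
  have hre : z.re = y * ‖1 + z‖ ^ 2 / 2 := by
    simp only [y]
    field_simp
  calc n * ‖2 * (z / (1 + z)) - 1‖ ^ n * z.re
      = (n * y * ‖2 * (z / (1 + z)) - 1‖ ^ n) * ‖1 + z‖ ^ 2 / 2 := by
        rw [hre]; ring
    _ ≤ 1 * ‖1 + z‖ ^ 2 / 2 := by gcongr
    _ ≤ ‖1 + z‖ ^ 2 := by nlinarith [sq_nonneg ‖1 + z‖]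

section Rate

variable {X : Type*} [NormedAddCommGroup X] [NormedSpace ℂ X] [CompleteSpace X]
  {A : X →ₗ.[ℂ] X} {T : ℝ → X →L[ℂ] X}
  {K : Set ℂ} [CompactSpace K] {Φ : C(K, ℂ) →ₐ[ℂ] (X →L[ℂ] X)}

/-- Decay of `T(t) (-A) ^ (-α)` like `1 / t` confines the spectrum: test the decay at the time
`t = 1 / Re (1 / z)`. -/
theorem IsInverseCalculus.exists_rpow_le_mul_re (hΦ : IsInverseCalculus A K Φ)
    (hK : ∀ z ∈ K, z = 0 ∨ 0 < z.re) (hT : IsC0Semigroup T) (hA : IsGenerator T A) {α : ℝ}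
    (hα : 0 < α)
    (hO : (fun t : ℝ => ‖T t * A.negFracPow α‖) =O[atTop] (fun t : ℝ => 1 / t)) :
    ∃ C ≥ 0, ∀ z ∈ K, ‖z‖ ^ (α + 2) ≤ C * z.re := by
  obtain ⟨c, hc, hcO⟩ := hO.exists_pos
  rw [IsBigOWith_def] at hcO
  obtain ⟨t₀, ht₀⟩ := eventually_atTop.1 hcO
  set s := max t₀ 1
  have hs : 0 < s := lt_max_of_lt_right one_pos
  set M := ‖coordinate K‖
  refine ⟨c * Real.exp 1 + M ^ α * s, by positivity, fun z hz => ?_⟩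
  rcases hK z hz with rfl | hre
  · rw [norm_zero, Real.zero_rpow (by linarith)]
    simp
  have hz0 : z ≠ 0 := by rintro rfl; simp at hre
  have hzn : 0 < ‖z‖ := norm_pos_iff.2 hz0
  have hzM : ‖z‖ ≤ M := (coordinate K).norm_coe_le_norm ⟨z, hz⟩
  set r := z.re / ‖z‖ ^ 2
  have hr : 0 < r := by positivity
  have hmain : ‖z‖ ^ α ≤ (c * Real.exp 1 + M ^ α * s) * r := by
    -- the decay estimate is available at time `1 / r` only if `1 / r ≥ s`; otherwise `r` is
    -- bounded below and the boundedness of `K` suffices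
    rcases le_total (s * r) 1 with h | h
    · have hle : s ≤ r⁻¹ := by rwa [← one_div, le_div_iff₀ hr]
      have h1 := ht₀ r⁻¹ ((le_max_left _ _).trans hle)
      have h2 := hΦ.norm_exp_mul_norm_le hT hA (l := ⟨z, hz⟩) hz0 (powSymbol hK hα)
        (inv_pos.2 hr).le
      have h3 : ((r⁻¹ : ℝ) * -z⁻¹ : ℂ).re = -1 := by
        rw [Complex.re_ofReal_mul, Complex.neg_re, Complex.inv_re, Complex.normSq_eq_norm_sq,
          mul_neg, inv_mul_cancel₀ hr.ne']
      rw [norm_norm, one_div, inv_inv, Real.norm_of_nonneg hr.le] at h1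
      rw [norm_powSymbol_apply, Complex.norm_exp, h3, ← hΦ.negFracPow_eq hK hα] at h2
      have h4 : ‖z‖ ^ α = Real.exp 1 * (Real.exp (-1) * ‖z‖ ^ α) := by
        rw [← mul_assoc, ← Real.exp_add]
        simp
      calc ‖z‖ ^ α = Real.exp 1 * (Real.exp (-1) * ‖z‖ ^ α) := h4
        _ ≤ Real.exp 1 * (c * r) := mul_le_mul_of_nonneg_left (h2.trans h1) (Real.exp_pos _).le
        _ ≤ (c * Real.exp 1 + M ^ α * s) * r := by
          have : 0 ≤ M ^ α * s * r := by positivity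
          linarith
    · have h1 : ‖z‖ ^ α ≤ M ^ α * (s * r) :=
        (Real.rpow_le_rpow hzn.le hzM hα.le).trans (le_mul_of_one_le_right (by positivity) h)
      have : 0 ≤ c * Real.exp 1 * r := by positivity
      linarith
  calc ‖z‖ ^ (α + 2) = ‖z‖ ^ α * ‖z‖ ^ 2 := by rw [Real.rpow_add hzn, Real.rpow_two]
    _ ≤ (c * Real.exp 1 + M ^ α * s) * r * ‖z‖ ^ 2 := by gcongr
    _ = (c * Real.exp 1 + M ^ α * s) * z.re := by
      simp only [r]
      field_simp

theorem IsInverseCalculus.isBigO_cayley_pow (hΦ : IsInverseCalculus A K Φ)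
    (hK : ∀ z ∈ K, z = 0 ∨ 0 < z.re) {α : ℝ} (hα : 0 < α) {C : ℝ} (hC : 0 ≤ C)
    (hle : ∀ z ∈ K, ‖z‖ ^ α ≤ C * z.re) :
    (fun n : ℕ => ‖A.cayley ^ n * A.negFracPow α‖) =O[atTop] (fun n : ℕ => 1 / (n : ℝ)) := by
  refine IsBigO.of_bound (C * (1 + ‖coordinate K‖) ^ 2) ?_
  filter_upwards [eventually_gt_atTop 0] with n hn
  have hn' : (0 : ℝ) < n := by exact_mod_cast hn
  rw [norm_norm, Real.norm_of_nonneg (by positivity), mul_one_div, hΦ.cayley_eq hK,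
    hΦ.negFracPow_eq hK hα, ← map_pow, ← map_mul]
  refine (hΦ.norm_le _).trans ?_
  rw [ContinuousMap.norm_le _ (by positivity)]
  intro z
  rw [le_div_iff₀ hn']
  have hz := re_nonneg_of_sector hK z.2
  have h1 := nat_mul_norm_cayley_pow_mul_re_le n hz
  have h2 : ‖1 + (z : ℂ)‖ ≤ 1 + ‖coordinate K‖ := by
    refine (norm_add_le _ _).trans ?_
    rw [norm_one]
    gcongr
    exact (coordinate K).norm_coe_le_norm z
  simp only [ContinuousMap.mul_apply, ContinuousMap.pow_apply, ContinuousMap.sub_apply,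
    ContinuousMap.smul_apply, ContinuousMap.one_apply, resolventSymbol_apply hK zero_le_one,
    Complex.ofReal_one, one_mul, smul_eq_mul]
  rw [norm_mul, norm_pow, norm_powSymbol_apply]
  set k := ‖2 * ((z : ℂ) / (1 + z)) - 1‖
  calc k ^ n * ‖(z : ℂ)‖ ^ α * n ≤ k ^ n * (C * (z : ℂ).re) * n := by
        gcongr
        exact hle z z.2
    _ = C * (n * k ^ n * (z : ℂ).re) := by ring
    _ ≤ C * (1 + ‖coordinate K‖) ^ 2 := by
      gcongr
      exact h1.trans (by gcongr)

/-- The rate transfer for every generator whose inverse has a contractive injective functional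
calculus on a compact subset of `{0} ∪ {Re > 0}`. -/
theorem IsInverseCalculus.cayley_rate (hΦ : IsInverseCalculus A K Φ)
    (hK : ∀ z ∈ K, z = 0 ∨ 0 < z.re) (hT : IsC0Semigroup T) (hA : IsGenerator T A) :
    (1 : ℂ) ∈ A.resolventSet ∧ (∀ β : ℝ, 0 < β → A.NegFracPowExists β) ∧
      ∀ α : ℝ, 0 < α →
        (fun t : ℝ => ‖T t * A.negFracPow α‖) =O[atTop] (fun t : ℝ => 1 / t) →
        (fun n : ℕ => ‖A.cayley ^ n * A.negFracPow (α + 2)‖) =O[atTop]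
          (fun n : ℕ => 1 / (n : ℝ)) := by
  refine ⟨by simpa using hΦ.mem_resolventSet hK zero_le_one,
    fun β hβ => hΦ.negFracPowExists hK hβ, fun α hα hO => ?_⟩
  obtain ⟨C, hC, hle⟩ := hΦ.exists_rpow_le_mul_re hK hT hA hα hO
  exact hΦ.isBigO_cayley_pow hK (by linarith) hC hle

end Rate

/-! ### The bounded inverse of an operator -/

section Inverse

variable {X : Type*} [NormedAddCommGroup X] [NormedSpace ℂ X] {A : X →ₗ.[ℂ] X} {B : X →L[ℂ] X}

theorem LinearPMap.IsResolventAt.mem_graph_iff (hB : A.IsResolventAt 0 B) {x y : X} :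
    (x, y) ∈ A.graph ↔ B y = -x := by
  rw [LinearPMap.mem_graph_iff]
  constructor
  · rintro ⟨u, rfl, rfl⟩
    have := hB.2 u
    rw [zero_smul, zero_sub, B.map_neg] at this
    exact neg_eq_iff_eq_neg.1 this
  · intro h
    refine ⟨⟨B (-y), hB.mem_domain _⟩, ?_, ?_⟩
    · exact (B.map_neg y).trans (by rw [h, neg_neg])
    · rw [hB.map_apply_zero, neg_neg]

/-- If `-1 / l` is in the resolvent set of `A`, then `l` is not in the spectrum of `(-A)⁻¹`: the
inverse of `1 + z B = (z - A) B` is `1 - z R(z, A)`, with `z = -1 / l`. -/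
theorem LinearPMap.IsResolventAt.notMem_spectrum (hB : A.IsResolventAt 0 B) {l : ℂ} (hl : l ≠ 0)
    (h : -l⁻¹ ∈ A.resolventSet) : l ∉ spectrum ℂ B := by
  obtain ⟨R, hR⟩ := h
  set z := -l⁻¹
  have h1 : B - z • (B * R) = R := by
    ext x
    obtain ⟨hx, h'⟩ := hR.1 x
    have := hB.2 ⟨R x, hx⟩
    have h2 : -A ⟨R x, hx⟩ = x - z • R x := by
      rw [eq_sub_iff_add_eq, neg_add_eq_sub]
      exact h'
    rw [zero_smul, zero_sub, h2, B.map_sub, B.map_smul] at this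
    exact this
  have h2 : R + z • (R * B) = B := by
    ext x
    have := hR.2 ⟨B x, hB.mem_domain x⟩
    rw [hB.map_apply_zero, sub_neg_eq_add, R.map_add, R.map_smul] at this
    simpa [add_comm] using this
  have h3 : IsUnit (1 + z • B) := by
    refine ⟨⟨1 + z • B, 1 - z • R, ?_, ?_⟩, rfl⟩
    · calc (1 + z • B) * (1 - z • R) = 1 - z • R + z • (B - z • (B * R)) := by
            simp only [mul_sub, add_mul, mul_one, one_mul, smul_sub, smul_mul_assoc,
              mul_smul_comm]
            module
        _ = 1 := by rw [h1]; abel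
    · calc (1 - z • R) * (1 + z • B) = 1 + z • B - z • (R + z • (R * B)) := by
            simp only [mul_add, sub_mul, mul_one, one_mul, smul_add, smul_mul_assoc,
              mul_smul_comm]
            module
        _ = 1 := by rw [h2]; abel
  rw [spectrum.notMem_iff, Algebra.algebraMap_eq_smul_one]
  have h4 : l • (1 : X →L[ℂ] X) - B = l • (1 + z • B) := by
    rw [smul_add, smul_smul, mul_neg, mul_inv_cancel₀ hl, neg_one_smul, sub_eq_add_neg]
  rw [h4]
  exact h3.smul (Units.mk0 l hl)

end Inverse

/-! ### Normal generators on Hilbert spaces -/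

section Hilbert

variable {H : Type*} [NormedAddCommGroup H] [InnerProductSpace ℂ H] [CompleteSpace H]
  {A : H →ₗ.[ℂ] H} {B : H →L[ℂ] H}

/-- `A† = -(B†)⁻¹` for `A = -B⁻¹`. -/
theorem LinearPMap.IsResolventAt.mem_adjoint_graph_iff (hd : Dense (A.domain : Set H))
    (hB : A.IsResolventAt 0 B) {x y : H} :
    (x, y) ∈ A†.graph ↔ ContinuousLinearMap.adjoint B y = -x := by
  rw [LinearPMap.adjoint_graph_eq_graph_adjoint hd, Submodule.mem_adjoint_iff]
  constructor
  · intro h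
    refine ext_inner_left ℂ fun v => ?_
    have := h (-B v) v (hB.mem_graph_iff.2 (by rw [neg_neg]))
    rw [inner_neg_left, sub_neg_eq_add] at this
    rw [ContinuousLinearMap.adjoint_inner_right, inner_neg_right]
    exact eq_neg_of_add_eq_zero_right this
  · intro h a b hab
    have hab' := hB.mem_graph_iff.1 hab
    have h1 := ContinuousLinearMap.adjoint_inner_right B b y
    rw [hab', h, inner_neg_left, inner_neg_right] at h1
    exact sub_eq_zero.2 (neg_injective h1)

/-- In terms of `B = (-A)⁻¹`, the graphs of `A† A` and `A A†` are those of the inverses of `B B†`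
and `B† B`. -/
theorem LinearPMap.IsNormal.isStarNormal_inverse (hA : A.IsNormal) (hB : A.IsResolventAt 0 B) :
    IsStarNormal B := by
  refine ⟨?_⟩
  rw [ContinuousLinearMap.star_eq_adjoint]
  ext z
  have h := hA.comm (ContinuousLinearMap.adjoint B (B z)) z
  simp only [hB.mem_graph_iff, hB.mem_adjoint_graph_iff hA.dense_domain] at h
  obtain ⟨y, h1, h2⟩ := h.2 ⟨-B z, by simp, by simp⟩
  rw [mul_apply_eq_comp, mul_apply_eq_comp, ← neg_neg (ContinuousLinearMap.adjoint B (B z)),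
    ← h1, ← B.map_neg, ← h2]

/-- The calculus is the continuous functional calculus of the bounded normal operator `(-A)⁻¹` on
its spectrum. -/
theorem IsGenerator.cayley_rate_of_isNormal {T : ℝ → H →L[ℂ] H} (hT : IsC0Semigroup T)
    (hbdd : IsUniformlyBounded T) (hA : IsGenerator T A)
    (hi : ∀ η : ℝ, Complex.I * (η : ℂ) ∈ A.resolventSet) (hn : A.IsNormal) :
    (1 : ℂ) ∈ A.resolventSet ∧ (∀ β : ℝ, 0 < β → A.NegFracPowExists β) ∧
      ∀ α : ℝ, 0 < α →
        (fun t : ℝ => ‖T t * A.negFracPow α‖) =O[atTop] (fun t : ℝ => 1 / t) →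
        (fun n : ℕ => ‖A.cayley ^ n * A.negFracPow (α + 2)‖) =O[atTop]
          (fun n : ℕ => 1 / (n : ℝ)) := by
  obtain ⟨B, hB⟩ : (0 : ℂ) ∈ A.resolventSet := by simpa using hi 0
  have hBn := hn.isStarNormal_inverse hB
  let Φ : C(spectrum ℂ B, ℂ) →ₐ[ℂ] (H →L[ℂ] H) := (cfcHom (R := ℂ) hBn).toAlgHom
  have hΦ : IsInverseCalculus A (spectrum ℂ B) Φ :=
    { norm_le := fun f => (norm_cfcHom B f hBn).le
      injective := cfcHom_injective hBn
      isResolventAt_zero := by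
        have : Φ (coordinate (spectrum ℂ B)) = B := cfcHom_id hBn
        rwa [this] }
  refine hΦ.cayley_rate (fun l hl => ?_) hT hA
  by_contra! h
  obtain ⟨hl0, hre⟩ := h
  obtain ⟨M, hM⟩ := hbdd
  have hns : 0 < Complex.normSq l := Complex.normSq_pos.2 hl0
  rcases hre.eq_or_lt with hre | hre
  -- `l` is purely imaginary, hence so is `-1 / l`, which lies in the resolvent set
  · refine hB.notMem_spectrum hl0 ?_ hl
    convert hi (-l⁻¹).im using 1
    apply Complex.ext <;> simp [Complex.inv_re, hre]
  -- `Re (-1 / l) > 0` would make `‖T(t)‖` grow exponentially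
  · set r := (-l⁻¹).re
    have hr : 0 < r := by
      simp only [r, Complex.neg_re, Complex.inv_re, ← neg_div]
      exact div_pos (neg_pos.2 hre) hns
    have hle : ∀ t : ℝ, 0 ≤ t → Real.exp (t * r) ≤ M := by
      intro t ht
      have h1 := hΦ.norm_exp_mul_norm_le hT hA (l := ⟨l, hl⟩) hl0 1 ht
      rw [Complex.norm_exp, Complex.re_ofReal_mul, map_one, mul_one, ContinuousMap.one_apply,
        norm_one, mul_one] at h1
      exact h1.trans (hM t ht)
    have hM0 : 0 < M := (Real.exp_pos _).trans_le (hle 0 le_rfl)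
    have h2 := hle (M / r) (by positivity)
    rw [div_mul_cancel₀ _ hr.ne'] at h2
    linarith [Real.add_one_le_exp M]

end Hilbert

/-! ### Multiplication operators on `L^p` -/

theorem re_pos_of_re_neg_inv_neg {z : ℂ} (h : (-z⁻¹).re < 0) : 0 < z.re := by
  have hz : z ≠ 0 := by rintro rfl; simp at h
  rw [Complex.neg_re, neg_lt_zero, Complex.inv_re] at h
  exact (div_pos_iff_of_pos_right (Complex.normSq_pos.2 hz)).1 h

section Lp

variable {Ω : Type*} [MeasurableSpace Ω] {μ : Measure Ω} {p : ℝ≥0∞}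

theorem memLp_mul_of_bound {h : Ω → ℂ} (hm : Measurable h) {c : ℝ} (hc : ∀ s, ‖h s‖ ≤ c)
    (f : Lp ℂ p μ) : MemLp (fun s => h s * f s) p μ := by
  refine (Lp.memLp f).of_le_mul (c := c)
    (hm.aestronglyMeasurable.mul (Lp.aestronglyMeasurable f)) (Eventually.of_forall fun s => ?_)
  rw [norm_mul]
  gcongr
  exact hc s

/-- Multiplication by a bounded measurable function, as a bounded operator on `L^p`. -/
noncomputable def lpMul [Fact (1 ≤ p)] (h : Ω → ℂ) (hm : Measurable h) {c : ℝ}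
    (hc : ∀ s, ‖h s‖ ≤ c) : Lp ℂ p μ →L[ℂ] Lp ℂ p μ :=
  LinearMap.mkContinuous
    { toFun := fun f => (memLp_mul_of_bound hm hc f).toLp
      map_add' := by
        intro f g
        rw [← MemLp.toLp_add]
        refine MemLp.toLp_congr _ _ ?_
        filter_upwards [Lp.coeFn_add f g] with s hs
        rw [hs]
        simp only [Pi.add_apply, mul_add]
      map_smul' := by
        intro a f
        rw [RingHom.id_apply, ← MemLp.toLp_const_smul]
        refine MemLp.toLp_congr _ _ ?_
        filter_upwards [Lp.coeFn_smul a f] with s hs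
        simp only [hs, Pi.smul_apply, smul_eq_mul]
        ring } c fun f => by
      refine Lp.norm_le_mul_norm_of_ae_le_mul ?_
      filter_upwards [(memLp_mul_of_bound hm hc f).coeFn_toLp] with s hs
      refine (congrArg norm hs).le.trans ?_
      rw [norm_mul]
      gcongr
      exact hc s

variable [Fact (1 ≤ p)]

theorem coeFn_lpMul {h : Ω → ℂ} (hm : Measurable h) {c : ℝ} (hc : ∀ s, ‖h s‖ ≤ c)
    (f : Lp ℂ p μ) : lpMul h hm hc f =ᵐ[μ] fun s => h s * f s :=
  (memLp_mul_of_bound hm hc f).coeFn_toLp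

theorem extend_coe_apply {K : Set ℂ} (g : K → ℂ) {z : ℂ} (hz : z ∈ K) :
    Function.extend ((↑) : K → ℂ) g 0 z = g ⟨z, hz⟩ :=
  Subtype.val_injective.extend_apply g 0 ⟨z, hz⟩

variable {K : Set ℂ} [CompactSpace K] {b : Ω → ℂ}

theorem measurable_extend_comp (hb : Measurable b) (g : C(K, ℂ)) :
    Measurable (fun s => Function.extend ((↑) : K → ℂ) g 0 (b s)) := by
  have hKm : MeasurableSet K := (isCompact_iff_compactSpace.2 ‹_›).measurableSet
  exact ((MeasurableEmbedding.subtype_coe hKm).measurable_extend g.continuous.measurable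
    measurable_const).comp hb

theorem norm_extend_le (g : C(K, ℂ)) (z : ℂ) :
    ‖Function.extend ((↑) : K → ℂ) g 0 z‖ ≤ ‖g‖ := by
  by_cases hz : z ∈ K
  · rw [extend_coe_apply g hz]
    exact g.norm_coe_le_norm _
  · rw [Function.extend_apply' _ _ _ (by simpa using hz)]
    simp

/-- Multiplication by `g ∘ b` on `L^p`, where `g` is extended by `0` off `K`. -/
noncomputable def lpCompMul (μ : Measure Ω) (p : ℝ≥0∞) [Fact (1 ≤ p)] (hb : Measurable b)
    (g : C(K, ℂ)) : Lp ℂ p μ →L[ℂ] Lp ℂ p μ :=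
  lpMul (fun s => Function.extend ((↑) : K → ℂ) g 0 (b s)) (measurable_extend_comp hb g)
    fun s => norm_extend_le g (b s)

theorem coeFn_lpCompMul (hb : Measurable b) (g : C(K, ℂ)) (f : Lp ℂ p μ) :
    ∀ᵐ s ∂μ, ∀ hs : b s ∈ K, lpCompMul μ p hb g f s = g ⟨b s, hs⟩ * f s := by
  filter_upwards [coeFn_lpMul (measurable_extend_comp hb g) (fun s => norm_extend_le g (b s)) f]
    with s h hs
  rw [← extend_coe_apply g hs]
  exact h

theorem lpCompMul_eq_of_ae (hb : Measurable b) (hbK : ∀ᵐ s ∂μ, b s ∈ K) {g : C(K, ℂ)}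
    {f f' : Lp ℂ p μ} (h : ∀ᵐ s ∂μ, ∀ hs : b s ∈ K, f' s = g ⟨b s, hs⟩ * f s) :
    lpCompMul μ p hb g f = f' := by
  refine Lp.ext ?_
  filter_upwards [coeFn_lpCompMul hb g f, h, hbK] with s h1 h2 hs
  rw [h1 hs, h2 hs]

/-- The functional calculus `g ↦ g ∘ b` of a multiplication operator on `L^p`, for a function `b`
with values in `K` almost everywhere. -/
noncomputable def lpCalculus (μ : Measure Ω) (p : ℝ≥0∞) [Fact (1 ≤ p)] (hb : Measurable b)
    (hbK : ∀ᵐ s ∂μ, b s ∈ K) : C(K, ℂ) →ₐ[ℂ] (Lp ℂ p μ →L[ℂ] Lp ℂ p μ) :=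
  AlgHom.ofLinearMap
    { toFun := lpCompMul μ p hb
      map_add' := fun g g' => by
        ext1 f
        refine lpCompMul_eq_of_ae hb hbK ?_
        filter_upwards [Lp.coeFn_add (lpCompMul μ p hb g f) (lpCompMul μ p hb g' f),
          coeFn_lpCompMul hb g f, coeFn_lpCompMul hb g' f] with s h1 h2 h3 hs
        refine h1.trans ?_
        rw [Pi.add_apply, h2 hs, h3 hs, ContinuousMap.add_apply, add_mul]
      map_smul' := fun a g => by
        ext1 f
        refine lpCompMul_eq_of_ae hb hbK ?_
        filter_upwards [Lp.coeFn_smul a (lpCompMul μ p hb g f), coeFn_lpCompMul hb g f]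
          with s h1 h2 hs
        refine h1.trans ?_
        rw [Pi.smul_apply, h2 hs, ContinuousMap.smul_apply, smul_eq_mul, smul_eq_mul, mul_assoc] }
    (by
      ext1 f
      exact lpCompMul_eq_of_ae hb hbK (Eventually.of_forall fun s hs => by simp))
    (fun g g' => by
      ext1 f
      refine lpCompMul_eq_of_ae hb hbK ?_
      filter_upwards [coeFn_lpCompMul hb g (lpCompMul μ p hb g' f), coeFn_lpCompMul hb g' f]
        with s h1 h2 hs
      refine (h1 hs).trans ?_
      rw [h2 hs, ContinuousMap.mul_apply, mul_assoc])

theorem coeFn_lpCalculus (hb : Measurable b) (hbK : ∀ᵐ s ∂μ, b s ∈ K) (g : C(K, ℂ))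
    (f : Lp ℂ p μ) :
    ∀ᵐ s ∂μ, ∀ hs : b s ∈ K, lpCalculus μ p hb hbK g f s = g ⟨b s, hs⟩ * f s :=
  coeFn_lpCompMul hb g f

theorem norm_lpCalculus_le (hb : Measurable b) (hbK : ∀ᵐ s ∂μ, b s ∈ K) (g : C(K, ℂ)) :
    ‖lpCalculus μ p hb hbK g‖ ≤ ‖g‖ := by
  change ‖lpCompMul μ p hb g‖ ≤ ‖g‖
  unfold lpCompMul lpMul
  exact LinearMap.mkContinuous_norm_le _ (norm_nonneg g) _

/-- If `g l ≠ 0` at some `l` in the support of the distribution of `b`, then multiplication by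
`g ∘ b` does not kill the indicator of a set of finite positive measure on which `g ∘ b ≠ 0`. -/
theorem lpCalculus_injective [SigmaFinite μ] (hb : Measurable b) (hbK : ∀ᵐ s ∂μ, b s ∈ K)
    (hsupp : K ⊆ (μ.map b).support) : Function.Injective (lpCalculus μ p hb hbK) := by
  rw [injective_iff_map_eq_zero]
  intro g hg
  ext l
  by_contra hl
  rw [ContinuousMap.zero_apply] at hl
  obtain ⟨V, hV, hVg⟩ := isOpen_induced_iff.1
    (isOpen_ne_fun g.continuous (continuous_const (y := (0 : ℂ))))
  have hlV : (l : ℂ) ∈ V := by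
    have : l ∈ ((↑) : K → ℂ) ⁻¹' V := hVg ▸ hl
    exact this
  have hpos : 0 < μ (b ⁻¹' V) := by
    rw [← Measure.map_apply hb hV.measurableSet]
    exact (Measure.mem_support_iff_forall _).1 (hsupp l.2) V (hV.mem_nhds hlV)
  obtain ⟨S, hS, hSV, hS0, hSfin⟩ :=
    Measure.exists_subset_measure_lt_top (hb hV.measurableSet) hpos
  have h1 := coeFn_lpCalculus (p := p) hb hbK g (indicatorConstLp p hS hSfin.ne 1)
  rw [hg] at h1
  refine hS0.ne' ?_
  rw [measure_eq_zero_iff_ae_notMem]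
  filter_upwards [h1, hbK,
    indicatorConstLp_coeFn (p := p) (hs := hS) (hμs := hSfin.ne) (c := (1 : ℂ)),
    Lp.coeFn_zero ℂ p μ] with s h2 h3 h4 h5 hsS
  have h2 := h2 h3
  rw [h4, indicator_of_mem hsS, mul_one] at h2
  have h6 : (⟨b s, h3⟩ : K) ∈ {z : K | g z ≠ 0} := by
    rw [← hVg]
    exact hSV hsS
  refine h6 (h2.symm.trans ?_)
  exact h5

variable [SigmaFinite μ] {φ : Ω → ℂ}

/-- The range space of the calculus is the essential range of `-1 / φ`, encoded as the support of
the distribution of `-1 / φ`. -/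
theorem IsGenerator.cayley_rate_of_lpMultiplication {T : ℝ → Lp ℂ p μ →L[ℂ] Lp ℂ p μ}
    (hφ : Measurable φ) (hneg : ∀ z ∈ essentialRange μ φ, z.re < 0) (hT : IsC0Semigroup T)
    (hA : IsGenerator T (lpMultiplication μ p φ)) :
    (1 : ℂ) ∈ (lpMultiplication μ p φ).resolventSet ∧
      (∀ β : ℝ, 0 < β → (lpMultiplication μ p φ).NegFracPowExists β) ∧
      ∀ α : ℝ, 0 < α →
        (fun t : ℝ => ‖T t * (lpMultiplication μ p φ).negFracPow α‖) =O[atTop]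
          (fun t : ℝ => 1 / t) →
        (fun n : ℕ => ‖(lpMultiplication μ p φ).cayley ^ n *
          (lpMultiplication μ p φ).negFracPow (α + 2)‖) =O[atTop] (fun n : ℕ => 1 / (n : ℝ)) := by
  let b : Ω → ℂ := fun s => -(φ s)⁻¹
  have hb : Measurable b := hφ.inv.neg
  have hφb : ∀ s, φ s = -(b s)⁻¹ := fun s => by simp [b, inv_neg]
  obtain ⟨ε, hε, hε0⟩ : ∃ ε : ℝ, 0 < ε ∧ μ {s | ‖φ s - 0‖ < ε} = 0 := by
    by_contra! h
    simpa using hneg 0 h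
  have hφε : ∀ᵐ s ∂μ, ε ≤ ‖φ s‖ := by
    filter_upwards [measure_eq_zero_iff_ae_notMem.1 hε0] with s hs
    simpa using hs
  set K := (μ.map b).support
  have hKb : K ⊆ Metric.closedBall 0 ε⁻¹ := by
    refine Measure.support_subset_of_isClosed Metric.isClosed_closedBall ?_
    rw [mem_ae_map_iff hb.aemeasurable Metric.isClosed_closedBall.measurableSet]
    filter_upwards [hφε] with s hs
    rw [mem_preimage, mem_closedBall_zero_iff, norm_neg, norm_inv]
    exact inv_anti₀ hε hs
  have hK : IsCompact K :=
    (isCompact_closedBall 0 ε⁻¹).of_isClosed_subset Measure.isClosed_support hKb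
  have : CompactSpace K := isCompact_iff_compactSpace.1 hK
  have hbK : ∀ᵐ s ∂μ, b s ∈ K := ae_of_ae_map hb.aemeasurable Measure.support_mem_ae
  have hΦ : IsInverseCalculus (lpMultiplication μ p φ) K (lpCalculus μ p hb hbK) := by
    refine ⟨norm_lpCalculus_le hb hbK, lpCalculus_injective hb hbK subset_rfl, ?_⟩
    have hB (f : Lp ℂ p μ) : ∀ᵐ s ∂μ, φ s * lpCalculus μ p hb hbK (coordinate K) f s = -f s := by
      filter_upwards [hφε, hbK, coeFn_lpCalculus hb hbK (coordinate K) f] with s h1 h2 h3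
      have : φ s ≠ 0 := norm_pos_iff.1 (hε.trans_le h1)
      rw [h3 h2, coordinate_apply]
      simp only [b]
      field_simp
    refine ⟨fun f => ⟨(Lp.memLp f).neg.ae_eq ?_, ?_⟩, fun f => ?_⟩
    · filter_upwards [hB f] with s hs
      exact hs.symm
    · rw [zero_smul, zero_sub, neg_eq_iff_eq_neg]
      refine Lp.ext ?_
      filter_upwards [hB f, Lp.coeFn_neg f, MemLp.coeFn_toLp (μ := μ) (p := p)
        (f := fun s => φ s * lpCalculus μ p hb hbK (coordinate K) f s)
        ((Lp.memLp f).neg.ae_eq (by filter_upwards [hB f] with s hs; exact hs.symm))]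
        with s h1 h2 h3
      rw [h2, Pi.neg_apply, ← h1]
      exact h3
    · rw [zero_smul, zero_sub]
      refine Lp.ext ?_
      filter_upwards [hφε, hbK, coeFn_lpCalculus hb hbK (coordinate K)
        (-lpMultiplication μ p φ f), Lp.coeFn_neg (lpMultiplication μ p φ f),
        MemLp.coeFn_toLp f.2] with s h1 h2 h3 h4 h5
      have h6 : φ s ≠ 0 := norm_pos_iff.1 (hε.trans_le h1)
      have h7 : lpMultiplication μ p φ f s = φ s * (f : Lp ℂ p μ) s := h5
      rw [h3 h2, h4, Pi.neg_apply, h7, coordinate_apply]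
      simp only [b]
      field_simp
  refine hΦ.cayley_rate (fun z hz => or_iff_not_imp_left.2 fun hz0 => ?_) hT hA
  refine re_pos_of_re_neg_inv_neg (hneg _ fun δ hδ h0 => ?_)
  have hU : {w : ℂ | ‖-w⁻¹ - -z⁻¹‖ < δ} ∈ 𝓝 z := by
    have h1 : ContinuousAt (fun w : ℂ => -w⁻¹) z := (continuousAt_inv₀ hz0).neg
    have h2 := Metric.tendsto_nhds.1 h1 δ hδ
    simp only [dist_eq_norm] at h2
    exact h2
  obtain ⟨V, hVU, hV, hzV⟩ := mem_nhds_iff.1 hU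
  have h3 := (Measure.mem_support_iff_forall _).1 hz V (hV.mem_nhds hzV)
  rw [Measure.map_apply hb hV.measurableSet] at h3
  refine h3.ne' (measure_mono_null (fun s hs => ?_) h0)
  have h4 := hVU hs
  rw [mem_ofPred_eq, ← hφb] at h4
  exact h4

end Lp

/-! ### Multiplication operators on `C₀` -/

section C0

variable {Ω : Type*} [TopologicalSpace Ω]

/-- Multiplication by a bounded continuous function, as a bounded operator on `C₀(Ω)`. -/
noncomputable def c0Mul (h : BoundedContinuousFunction Ω ℂ) : C₀(Ω, ℂ) →L[ℂ] C₀(Ω, ℂ) :=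
  LinearMap.mkContinuous
    { toFun := fun f =>
        { toFun := fun s => h s * f s
          continuous_toFun := h.continuous.mul f.continuous
          zero_at_infty' := by
            have h1 := (zero_at_infty f).norm.const_mul ‖h‖
            rw [norm_zero, mul_zero] at h1
            refine squeeze_zero_norm (fun s => ?_) h1
            rw [norm_mul]
            gcongr
            exact h.norm_coe_le_norm s }
      map_add' := fun f g => by
        ext s
        exact mul_add _ _ _
      map_smul' := fun a f => by
        ext s
        exact mul_left_comm _ _ _ } ‖h‖ fun f => by
    rw [← ZeroAtInftyContinuousMap.norm_toBCF_eq_norm,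
      ← ZeroAtInftyContinuousMap.norm_toBCF_eq_norm,
      BoundedContinuousFunction.norm_le (by positivity)]
    intro s
    refine (norm_mul_le (h s) (f s)).trans ?_
    gcongr
    · exact h.norm_coe_le_norm s
    · exact f.toBCF.norm_coe_le_norm s

theorem norm_c0Mul_le (h : BoundedContinuousFunction Ω ℂ) : ‖c0Mul h‖ ≤ ‖h‖ :=
  LinearMap.mkContinuous_norm_le _ (norm_nonneg h) _

variable {K : Set ℂ} [CompactSpace K]

/-- The functional calculus `g ↦ g ∘ b` of a multiplication operator on `C₀(Ω)`, for a continuous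
function `b` with values in `K`. -/
noncomputable def c0Calculus (b : C(Ω, K)) : C(K, ℂ) →ₐ[ℂ] (C₀(Ω, ℂ) →L[ℂ] C₀(Ω, ℂ)) :=
  AlgHom.ofLinearMap
    { toFun := fun g => c0Mul ((BoundedContinuousFunction.mkOfCompact g).compContinuous b)
      map_add' := fun g g' => by
        ext f s
        exact add_mul _ _ _
      map_smul' := fun a g => by
        ext f s
        exact mul_assoc _ _ _ }
    (by
      ext f s
      exact one_mul _)
    (fun g g' => by
      ext f s
      exact mul_assoc _ _ _)

@[simp]
theorem c0Calculus_apply (b : C(Ω, K)) (g : C(K, ℂ)) (f : C₀(Ω, ℂ)) (s : Ω) :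
    c0Calculus b g f s = g (b s) * f s := rfl

theorem norm_c0Calculus_le (b : C(Ω, K)) (g : C(K, ℂ)) : ‖c0Calculus b g‖ ≤ ‖g‖ := by
  refine (norm_c0Mul_le _).trans ?_
  rw [BoundedContinuousFunction.norm_le (norm_nonneg _)]
  exact fun s => g.norm_coe_le_norm (b s)

variable [LocallyCompactSpace Ω] [T2Space Ω]

/-- A function vanishing on the dense range of `b` vanishes; values at single points are detected by
Urysohn functions. -/
theorem c0Calculus_injective (b : C(Ω, K)) (hb : DenseRange b) :
    Function.Injective (c0Calculus b) := by
  rw [injective_iff_map_eq_zero]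
  intro g hg
  have h0 : ∀ s, g (b s) = 0 := by
    intro s
    obtain ⟨f, hf1, -, hf, -⟩ := exists_continuous_one_zero_of_isCompact
      (isCompact_singleton (x := s)) isClosed_empty (disjoint_empty _)
    let f' : C₀(Ω, ℂ) :=
      { toFun := fun s => (f s : ℂ)
        continuous_toFun := by fun_prop
        zero_at_infty' := by
          have : HasCompactSupport fun s => (f s : ℂ) :=
            hf.comp_left (g := fun x : ℝ => (x : ℂ)) (by simp)
          exact this.is_zero_at_infty }
    have h1 := DFunLike.congr_fun (DFunLike.congr_fun hg f') s
    have h2 : (f' s : ℂ) = 1 := by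
      change ((f s : ℝ) : ℂ) = 1
      rw [hf1 rfl]
      simp
    rw [c0Calculus_apply, h2, mul_one] at h1
    exact h1
  ext z
  exact congrFun (hb.equalizer g.continuous continuous_const (funext h0)) z

/-- The calculus lives on the closure of the range of `-1 / φ`. -/
theorem IsGenerator.cayley_rate_of_c0Multiplication {φ : Ω → ℂ}
    {T : ℝ → C₀(Ω, ℂ) →L[ℂ] C₀(Ω, ℂ)} (hφ : Continuous φ)
    (hneg : ∀ z ∈ closure (range φ), z.re < 0) (hT : IsC0Semigroup T)
    (hA : IsGenerator T (c0Multiplication φ)) :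
    (1 : ℂ) ∈ (c0Multiplication φ).resolventSet ∧
      (∀ β : ℝ, 0 < β → (c0Multiplication φ).NegFracPowExists β) ∧
      ∀ α : ℝ, 0 < α →
        (fun t : ℝ => ‖T t * (c0Multiplication φ).negFracPow α‖) =O[atTop]
          (fun t : ℝ => 1 / t) →
        (fun n : ℕ => ‖(c0Multiplication φ).cayley ^ n *
          (c0Multiplication φ).negFracPow (α + 2)‖) =O[atTop] (fun n : ℕ => 1 / (n : ℝ)) := by
  have h0 : (0 : ℂ) ∉ closure (range φ) := fun h => by simpa using hneg 0 h
  obtain ⟨ε, hε, hball⟩ : ∃ ε > 0, ∀ s, ε ≤ ‖φ s‖ := by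
    rw [Metric.mem_closure_range_iff] at h0
    push Not at h0
    simpa using h0
  have hφ0 : ∀ s, φ s ≠ 0 := fun s => norm_pos_iff.1 (hε.trans_le (hball s))
  let b₀ : Ω → ℂ := fun s => -(φ s)⁻¹
  have hb₀ : Continuous b₀ := (hφ.inv₀ hφ0).neg
  set K := closure (range b₀)
  have hK : IsCompact K := by
    refine (isCompact_closedBall (0 : ℂ) ε⁻¹).of_isClosed_subset isClosed_closure
      (closure_minimal ?_ Metric.isClosed_closedBall)
    rintro _ ⟨s, rfl⟩
    rw [mem_closedBall_zero_iff, norm_neg, norm_inv]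
    exact inv_anti₀ hε (hball s)
  have : CompactSpace K := isCompact_iff_compactSpace.1 hK
  let b : C(Ω, K) := ⟨fun s => ⟨b₀ s, subset_closure (mem_range_self s)⟩, by fun_prop⟩
  have hbd : DenseRange b := by
    intro z
    rw [closure_subtype, ← range_comp]
    exact z.2
  have hφb : ∀ s, φ s * b s = -1 := fun s => by
    simp only [b, b₀, ContinuousMap.coe_mk]
    rw [mul_neg, mul_inv_cancel₀ (hφ0 s)]
  have hΦ : IsInverseCalculus (c0Multiplication φ) K (c0Calculus b) := by
    refine ⟨norm_c0Calculus_le b, c0Calculus_injective b hbd, fun f => ⟨⟨-f, fun s => ?_⟩, ?_⟩,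
      fun f => ?_⟩
    · rw [c0Calculus_apply, coordinate_apply, ← mul_assoc, hφb, neg_one_mul]
      rfl
    · rw [zero_smul, zero_sub, neg_eq_iff_eq_neg]
      ext s
      rw [c0Multiplication_apply, c0Calculus_apply, coordinate_apply, ← mul_assoc, hφb,
        neg_one_mul]
      rfl
    · rw [zero_smul, zero_sub]
      ext s
      rw [c0Calculus_apply, coordinate_apply, ZeroAtInftyContinuousMap.neg_apply,
        c0Multiplication_apply, mul_neg, ← mul_assoc, mul_comm (b s : ℂ), hφb, neg_one_mul, neg_neg]
  refine hΦ.cayley_rate (fun z hz => or_iff_not_imp_left.2 fun hz0 => ?_) hT hA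
  refine re_pos_of_re_neg_inv_neg (hneg _ ?_)
  have h1 : ContinuousAt (fun w : ℂ => -w⁻¹) z := (continuousAt_inv₀ hz0).neg
  have h2 := mem_closure_image h1 hz
  rw [← range_comp] at h2
  convert h2 using 3
  ext s
  simp [b₀, inv_neg]

end C0

/-! ### The three classes of generators -/

theorem mainTheorem2 :
    -- normal generators on Hilbert spaces
    (∀ (H : Type*) [NormedAddCommGroup H] [InnerProductSpace ℂ H] [CompleteSpace H]
      (T : ℝ → H →L[ℂ] H) (A : H →ₗ.[ℂ] H),
      IsC0Semigroup T → IsUniformlyBounded T → IsGenerator T A →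
      (∀ η : ℝ, Complex.I * (η : ℂ) ∈ A.resolventSet) → A.IsNormal →
      (1 : ℂ) ∈ A.resolventSet ∧ (∀ β : ℝ, 0 < β → A.NegFracPowExists β) ∧
      ∀ α : ℝ, 0 < α →
        (fun t : ℝ => ‖T t * A.negFracPow α‖) =O[atTop] (fun t : ℝ => 1 / t) →
        (fun n : ℕ => ‖A.cayley ^ n * A.negFracPow (α + 2)‖) =O[atTop]
          (fun n : ℕ => 1 / (n : ℝ))) ∧
    -- multiplication operators on `L^p`
    (∀ (Ω : Type*) [TopologicalSpace Ω] [LocallyCompactSpace Ω] [T2Space Ω]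
      [MeasurableSpace Ω] [BorelSpace Ω] (μ : Measure Ω) [SigmaFinite μ] [μ.Regular]
      (p : ℝ≥0∞) [Fact (1 ≤ p)] (φ : Ω → ℂ) (T : ℝ → Lp ℂ p μ →L[ℂ] Lp ℂ p μ)
      (A : Lp ℂ p μ →ₗ.[ℂ] Lp ℂ p μ),
      p ≠ ∞ → Measurable φ → (∀ z ∈ essentialRange μ φ, z.re < 0) →
      A = lpMultiplication μ p φ → IsC0Semigroup T → IsGenerator T A →
      (1 : ℂ) ∈ A.resolventSet ∧ (∀ β : ℝ, 0 < β → A.NegFracPowExists β) ∧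
      ∀ α : ℝ, 0 < α →
        (fun t : ℝ => ‖T t * A.negFracPow α‖) =O[atTop] (fun t : ℝ => 1 / t) →
        (fun n : ℕ => ‖A.cayley ^ n * A.negFracPow (α + 2)‖) =O[atTop]
          (fun n : ℕ => 1 / (n : ℝ))) ∧
    -- multiplication operators on `C₀`
    (∀ (Ω : Type*) [TopologicalSpace Ω] [LocallyCompactSpace Ω] [T2Space Ω]
      (φ : Ω → ℂ) (T : ℝ → C₀(Ω, ℂ) →L[ℂ] C₀(Ω, ℂ)) (A : C₀(Ω, ℂ) →ₗ.[ℂ] C₀(Ω, ℂ)),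
      Continuous φ → (∀ z ∈ closure (range φ), z.re < 0) →
      A = c0Multiplication φ → IsC0Semigroup T → IsGenerator T A →
      (1 : ℂ) ∈ A.resolventSet ∧ (∀ β : ℝ, 0 < β → A.NegFracPowExists β) ∧
      ∀ α : ℝ, 0 < α →
        (fun t : ℝ => ‖T t * A.negFracPow α‖) =O[atTop] (fun t : ℝ => 1 / t) →
        (fun n : ℕ => ‖A.cayley ^ n * A.negFracPow (α + 2)‖) =O[atTop]
          (fun n : ℕ => 1 / (n : ℝ))) := by
  exact ⟨fun H _ _ _ T A hT hbdd hA hi hn => hA.cayley_rate_of_isNormal hT hbdd hi hn,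
    fun Ω _ _ _ _ _ μ _ _ p _ φ T A _ hφ hneg hAφ hT hA => by
      subst hAφ
      exact hA.cayley_rate_of_lpMultiplication hφ hneg hT,
    fun Ω _ _ _ φ T A hφ hneg hAφ hT hA => by
      subst hAφ
      exact hA.cayley_rate_of_c0Multiplication hφ hneg hT⟩
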